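/- Let $K$ be a field of characteristic zero with a non-trivial non-Archimedean absolute value $|\cdot|$, and let $v$ be the valuation with $|x|=e^{-v(x)}$ for $x\in K^\times$. Let $n\ge 2$, let $V$ be a $K$-vector space with basis $e_1,\dots,e_n$, and let $T\subset SL(V)$ be the torus of endomorphisms that are diagonal in this basis. Write $a_i(\mathrm{diag}(s_1,\dots,s_n))=s_i$, so that $X^*(T)=\bigoplus_i\mathbb Z a_i/\mathbb Z(a_1+\dots+a_n)$, and let $\Phi=\{a_i-a_j: i\ne j\}\subset X^*(T)$ be the root system (characters written additively). Let $A=\{x\in\mathbb R^n:\sum_i x_i=0\}$ be the apartment of $T$, paired with $X^*(T)$ by $(\sum_i m_ia_i)(x)=\sum_i m_ix_i$, and let $\mathbb T^{n-1}=\mathbb R^n/\mathbb R(1,\dots,1)$. The composite $A\subset\mathbb R^n\to\mathbb T^{n-1}$ identifies $A$ with $\mathbb T^{n-1}$. Let $\lambda=(\lambda_1\ge\dots\ge\lambda_n\ge 0)$ be a partition, with Schur polynomial $$S_\lambda(z_1,\dots,z_n)=\frac{\det(z_j^{\lambda_i+n-i})_{i,j}}{\det(z_j^{n-i})_{i,j}}=\sum_N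 c_N z^N\in K[z_1,\dots,z_n].$$ Let $\mathfrak S_\lambda(V)$ be the irreducible representation of $SL(V)$ associated with $\lambda$, i.e. the image of the Young symmetrizer of $\lambda$ on $V^{\otimes(\lambda_1+\dots+\lambda_n)}$, and let $\rho: SL(V)\to GL(W)$ be a representation isomorphic to $\mathfrak S_\lambda(V)$. A weight of $\rho$ is a $\mu\in X^*(T)$ for which some non-zero $w\in W$ satisfies $\rho(t)w=\mu(t)w$ for all $t\in T(K)$. A basis of $\Phi$ is a linearly independent subset $\Delta\subset\Phi$ such that every root is an integral combination of $\Delta$ with all coefficients $\ge 0$ or all coefficients $\le 0$. The highest weight $\mu_0(\Delta)$ is the weight for which $\mu_0(\Delta)-\mu$ is a combination of $\Delta$ with non-negative integral coefficients for every weight $\mu$ of $\rho$. The fan $\mathcal F_\rho$ is the set of all non-empty faces of the cones $$C_\Delta(\rho)=\{x\in A:\ \mu_0(\Delta)(x)\ge\mu(x)\text{ for all weights }\mu\text{ of }\rho\},$$ where $\Delta$ runs over the bases of $\Phi$. Let $P\subset\mathbb R^{n+1}$ be the extended Newton polytope of $S_\lambda$, the convex hull of all points $(-v(c_N),\nu_1,\dots,\nu_n)$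 with $N=(\nu_1,\dots,\nu_n)$ and $c_N\ne 0$. For a non-empty face $F$ of $P$ put $\mathcal N_P(F)=\{w\in\mathbb R^{n+1}: F\subset\{x\in P:\langle w,x\rangle=\max_{y\in P}\langle w,y\rangle\}\}$ with coordinates $w=(w_0,\dots,w_n)$. The polyhedral complex $\mathcal C(S_\lambda)$ in $\mathbb R^n\cong\{w_0=-1\}$ is the collection of all cells $\mathcal N_P(F)\cap\{w_0=-1\}$, where $F$ runs over the non-empty faces of $P$. Assume that all the (non-zero) coefficients $c_N$ of $S_\lambda$ have valuation zero. Then, under the identification $A\simeq\mathbb T^{n-1}$, the fan $\mathcal F_\rho$ coincides with the image of $\mathcal C(S_\lambda)$ under the map $\mathbb R^n\to\mathbb T^{n-1}$: the cones of $\mathcal F_\rho$ are exactly the images of the cells of $\mathcal C(S_\lambda)$. -/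

import Mathlib

namespace TropicalSchur

noncomputable section

/-! ## The Schur polynomial -/

/-- The alternant `det (z_j ^ (m_i))`, as a polynomial in `z_1, …, z_n`. -/
def alternant (K : Type*) [CommRing K] {n : ℕ} (m : Fin n → ℕ) : MvPolynomial (Fin n) K :=
  Matrix.det (Matrix.of fun i j : Fin n => (MvPolynomial.X j : MvPolynomial (Fin n) K) ^ m i)

/-- The denominator `det (z_j ^ (n - i))` divides every alternant. For `i : Fin n` (counted
from `0`) the number `(i.rev : ℕ)` is `n - 1 - i`, i.e. `n - i` when rows are counted from `1`. -/
theorem alternant_dvd (K : Type*) [CommRing K] {n : ℕ} (m : Fin n → ℕ) :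
    alternant K (fun i : Fin n => (i.rev : ℕ)) ∣ alternant K m := by
  nontriviality K
  let R := MvPolynomial (Fin n) K
  let Q : Polynomial R := ∏ j : Fin n, (Polynomial.X - Polynomial.C (MvPolynomial.X j))
  have hQ : Q.Monic := Polynomial.monic_prod_of_monic _ _ fun j _ => Polynomial.monic_X_sub_C _
  have hdeg : Q.natDegree = n := by
    have h := Polynomial.natDegree_prod_of_monic Finset.univ
      (fun j : Fin n => (Polynomial.X - Polynomial.C (MvPolynomial.X j : R) : Polynomial R))
      fun j _ => Polynomial.monic_X_sub_C _
    exact h.trans (by simp only [Polynomial.natDegree_X_sub_C]; simp)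
  let r : Fin n → Polynomial R := fun i => (Polynomial.X ^ m i) %ₘ Q
  have hr : ∀ i j, (r i).eval (MvPolynomial.X j) = (MvPolynomial.X j : R) ^ m i := by
    intro i j
    have hroot : Q.eval (MvPolynomial.X j) = 0 := by
      simp only [Q, Polynomial.eval_prod]
      exact Finset.prod_eq_zero (Finset.mem_univ j) (by simp)
    have := congrArg (Polynomial.eval (MvPolynomial.X j : R))
      (Polynomial.modByMonic_add_div (Polynomial.X ^ m i) Q)
    simpa [hroot] using this
  have hM : (Matrix.of fun i j : Fin n => (MvPolynomial.X j : R) ^ m i) =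
      (Matrix.of fun i k : Fin n => (r i).coeff (k.rev : ℕ)) *
        (Matrix.of fun k j : Fin n => (MvPolynomial.X j : R) ^ (k.rev : ℕ)) := by
    ext1 i j
    have hlt : (r i).degree < (n : ℕ) := by
      have := Polynomial.degree_modByMonic_lt (Polynomial.X ^ m i) hQ
      rwa [Polynomial.degree_eq_natDegree hQ.ne_zero, hdeg] at this
    have h1 : (r i).eval (MvPolynomial.X j) =
        ∑ k : Fin n, (r i).coeff (k : ℕ) * (MvPolynomial.X j : R) ^ (k : ℕ) := by
      rw [Polynomial.eval_eq_sum]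
      exact (Polynomial.sum_fin (fun k c => c * (MvPolynomial.X j : R) ^ k) (by simp) hlt).symm
    rw [Matrix.mul_apply]
    simp only [Matrix.of_apply]
    rw [← hr i j, h1]
    exact (Equiv.sum_comp Fin.revPerm
      (fun k : Fin n => (r i).coeff (k : ℕ) * (MvPolynomial.X j : R) ^ (k : ℕ))).symm
  refine ⟨Matrix.det (Matrix.of fun i k : Fin n => (r i).coeff (k.rev : ℕ)), ?_⟩
  unfold alternant
  rw [hM, Matrix.det_mul, mul_comm]

/-- The Schur polynomial
`S_λ = det (z_j ^ (λ_i + n - i)) / det (z_j ^ (n - i))` in `K[z_1, …, z_n]`. -/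
def schurPoly (K : Type*) [CommRing K] {n : ℕ} (lam : Fin n → ℕ) : MvPolynomial (Fin n) K :=
  (alternant_dvd K (fun i => lam i + (i.rev : ℕ))).choose

theorem schurPoly_spec (K : Type*) [CommRing K] {n : ℕ} (lam : Fin n → ℕ) :
    alternant K (fun i => lam i + (i.rev : ℕ)) =
      alternant K (fun i : Fin n => (i.rev : ℕ)) * schurPoly K lam :=
  (alternant_dvd K (fun i => lam i + (i.rev : ℕ))).choose_spec

/-! ## The representation `𝔖_λ(V)` -/

/-- The boxes of the Young diagram of `λ`: the box `⟨i, j⟩` lies in row `i` and column `j`. -/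
abbrev Box {n : ℕ} (lam : Fin n → ℕ) : Type := Σ i : Fin n, Fin (lam i)

section SchurModule

variable (K : Type*) [Field K] (V : Type*) [AddCommGroup V] [Module K V]
variable {n : ℕ} (lam : Fin n → ℕ)

/-- The tensor power of `V` whose factors are indexed by the boxes of `λ`. -/
abbrev TensorPower : Type _ := PiTensorProduct K (fun _ : Box lam => V)

/-- Permutation of the tensor factors: `⨂ v_b ↦ ⨂ v_{σ⁻¹ b}`. -/
def permAct (s : Equiv.Perm (Box lam)) : TensorPower K V lam →ₗ[K] TensorPower K V lam :=
  (PiTensorProduct.reindex K (fun _ : Box lam => V) s).toLinearMap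

open Classical in
/-- Sum over all permutations of the boxes preserving each row. -/
def rowSymmetrizer : TensorPower K V lam →ₗ[K] TensorPower K V lam :=
  ∑ s : Equiv.Perm (Box lam) with ∀ b, (s b).1 = b.1, permAct K V lam s

open Classical in
/-- Signed sum over all permutations of the boxes preserving each column. -/
def colAntisymmetrizer : TensorPower K V lam →ₗ[K] TensorPower K V lam :=
  ∑ s : Equiv.Perm (Box lam) with ∀ b, ((s b).2 : ℕ) = (b.2 : ℕ),
    ((Equiv.Perm.sign s : ℤ) : K) • permAct K V lam s

/-- The Young symmetrizer of `λ`, acting on the tensor power. -/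
def youngSymmetrizer : TensorPower K V lam →ₗ[K] TensorPower K V lam :=
  colAntisymmetrizer K V lam ∘ₗ rowSymmetrizer K V lam

/-- The diagonal action of `SL(V)` on the tensor power. -/
def tensorRep : Representation K (SpecialLinearGroup K V) (TensorPower K V lam) where
  toFun g := PiTensorProduct.map fun _ => (g.1 : V →ₗ[K] V)
  map_one' := PiTensorProduct.map_one
  map_mul' g h := PiTensorProduct.map_mul (fun _ => (g.1 : V →ₗ[K] V)) fun _ => (h.1 : V →ₗ[K] V)

theorem tensorRep_permAct (g : SpecialLinearGroup K V) (s : Equiv.Perm (Box lam))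
    (x : TensorPower K V lam) :
    tensorRep K V lam g (permAct K V lam s x) = permAct K V lam s (tensorRep K V lam g x) :=
  PiTensorProduct.map_reindex (fun _ : Box lam => (g.1 : V →ₗ[K] V)) s x

theorem tensorRep_youngSymmetrizer (g : SpecialLinearGroup K V) (x : TensorPower K V lam) :
    tensorRep K V lam g (youngSymmetrizer K V lam x) =
      youngSymmetrizer K V lam (tensorRep K V lam g x) := by
  simp [youngSymmetrizer, colAntisymmetrizer, rowSymmetrizer, tensorRep_permAct]

/-- The Schur module `𝔖_λ(V)`: the image of the Young symmetrizer on the tensor power of `V`,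
as a subrepresentation of `SL(V)`. -/
def schurSubrep : Subrepresentation (tensorRep K V lam) where
  toSubmodule := LinearMap.range (youngSymmetrizer K V lam)
  apply_mem_toSubmodule := by
    rintro g _ ⟨x, rfl⟩
    exact ⟨tensorRep K V lam g x, (tensorRep_youngSymmetrizer K V lam g x).symm⟩

/-- The representation of `SL(V)` on `𝔖_λ(V)`. -/
def schurRep : Representation K (SpecialLinearGroup K V) (schurSubrep K V lam).toSubmodule :=
  (schurSubrep K V lam).toRepresentation

end SchurModule

/-! ## The torus, its characters, and the weights of a representation -/

/-- The `K`-points of the diagonal torus `T` of `SL_n`. -/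
abbrev Torus (K : Type*) [Field K] (n : ℕ) : Type _ := {t : Fin n → Kˣ // ∏ i, t i = 1}

/-- The element `diag (t_1, …, t_n)` of `SL(V)` with respect to the basis `e` of `V`. -/
def torusElt {K V : Type*} [Field K] [AddCommGroup V] [Module K V] {n : ℕ}
    (e : Module.Basis (Fin n) K V) (t : Torus K n) : SpecialLinearGroup K V :=
  ⟨e.equiv (e.unitsSMul t.1) (Equiv.refl _), by
    apply Units.ext
    rw [LinearEquiv.coe_det, ← LinearMap.det_toMatrix e]
    have : LinearMap.toMatrix e e
        ((e.equiv (e.unitsSMul t.1) (Equiv.refl _) : V ≃ₗ[K] V) : V →ₗ[K] V) =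
        Matrix.diagonal fun i => ((t.1 i : Kˣ) : K) := by
      ext i j
      by_cases h : i = j
      · subst h
        simp [LinearMap.toMatrix_apply, Module.Basis.unitsSMul_apply, Units.smul_def]
      · simp [LinearMap.toMatrix_apply, Module.Basis.unitsSMul_apply, Units.smul_def,
          Matrix.diagonal_apply_ne _ h, Ne.symm h]
    rw [this, Matrix.det_diagonal, ← Units.coe_prod, t.2]⟩

theorem torusElt_apply {K V : Type*} [Field K] [AddCommGroup V] [Module K V] {n : ℕ}
    (e : Module.Basis (Fin n) K V) (t : Torus K n) (i : Fin n) :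
    torusElt e t (e i) = (t.1 i : K) • e i := by
  simp [torusElt, Module.Basis.unitsSMul_apply, Units.smul_def]

/-- The character lattice `X^*(T) = (⨁ ℤ a_i) / ℤ (a_1 + ⋯ + a_n)`. -/
abbrev CharLattice (n : ℕ) : Type :=
  (Fin n → ℤ) ⧸ AddSubgroup.zmultiples (fun _ : Fin n => (1 : ℤ))

/-- The class of `m_1 a_1 + ⋯ + m_n a_n` in `X^*(T)`. -/
def charMk {n : ℕ} (m : Fin n → ℤ) : CharLattice n := QuotientAddGroup.mk m

/-- The value `μ(t) ∈ Kˣ` of a character at a point of the torus; the class of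
`m_1 a_1 + ⋯ + m_n a_n` takes the value `∏ t_i ^ m_i`. -/
def charEval {K : Type*} [Field K] {n : ℕ} (t : Torus K n) : CharLattice n →+ Additive Kˣ :=
  QuotientAddGroup.lift _
    { toFun := fun m => Additive.ofMul (∏ i, t.1 i ^ m i)
      map_zero' := by simp
      map_add' := fun a b => by simp [zpow_add, Finset.prod_mul_distrib] }
    (by
      rw [AddSubgroup.zmultiples_le]
      change Additive.ofMul (∏ i, t.1 i ^ (1 : ℤ)) = 0
      simp [t.2])

/-- The weight space `W_μ = {w : ρ(t) w = μ(t) w for all t ∈ T(K)}`. -/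
def weightSpace {K V W : Type*} [Field K] [AddCommGroup V] [Module K V] [AddCommGroup W]
    [Module K W] {n : ℕ} (e : Module.Basis (Fin n) K V)
    (ρ : Representation K (SpecialLinearGroup K V) W) (μ : CharLattice n) : Set W :=
  {w | ∀ t : Torus K n, ρ (torusElt e t) w = ((charEval t μ).toMul : K) • w}

/-- `μ` is a weight of `ρ` if `W_μ ≠ 0`. -/
def IsWeight {K V W : Type*} [Field K] [AddCommGroup V] [Module K V] [AddCommGroup W]
    [Module K W] {n : ℕ} (e : Module.Basis (Fin n) K V)
    (ρ : Representation K (SpecialLinearGroup K V) W) (μ : CharLattice n) : Prop :=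
  ∃ w ∈ weightSpace e ρ μ, w ≠ 0

/-! ## Roots, bases and highest weights -/

/-- The root system of `SL(V)`: the characters `a_{ij} = a_i - a_j` (written additively)
for `i ≠ j`. -/
def roots (n : ℕ) : Set (CharLattice n) :=
  {a | ∃ i j : Fin n, i ≠ j ∧ a = charMk (Pi.single i 1 - Pi.single j 1)}

/-- `Δ` is a basis of the root system: a linearly independent set of roots such that every root
is an integral combination of `Δ` with all coefficients `≥ 0` or all coefficients `≤ 0`. -/
structure IsRootBasis {n : ℕ} (Δ : Finset (CharLattice n)) : Prop where
  subset : (Δ : Set (CharLattice n)) ⊆ roots n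
  linearIndependent : LinearIndependent ℤ (fun c : Δ => (c : CharLattice n))
  sameSign : ∀ a ∈ roots n, ∃ m : CharLattice n → ℤ, a = ∑ c ∈ Δ, m c • c ∧
    ((∀ c ∈ Δ, 0 ≤ m c) ∨ (∀ c ∈ Δ, m c ≤ 0))

/-- `μ₀` is the highest weight `μ_0(Δ)` of `ρ`: it is a weight, and for every weight `μ` the
difference `μ₀ - μ` is a combination of `Δ` with non-negative integral coefficients. -/
def IsHighestWeight {K V W : Type*} [Field K] [AddCommGroup V] [Module K V] [AddCommGroup W]
    [Module K W] {n : ℕ} (e : Module.Basis (Fin n) K V)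
    (ρ : Representation K (SpecialLinearGroup K V) W) (Δ : Finset (CharLattice n))
    (μ₀ : CharLattice n) : Prop :=
  IsWeight e ρ μ₀ ∧
    ∀ μ, IsWeight e ρ μ → ∃ k : CharLattice n → ℕ, μ₀ - μ = ∑ c ∈ Δ, k c • c

/-! ## The apartment and the tropical torus -/

/-- The apartment `A = X_*(T) ⊗ ℝ = {∑ x_i η_i : ∑ x_i = 0}`. -/
def Apartment (n : ℕ) : Submodule ℝ (Fin n → ℝ) where
  carrier := {x | ∑ i, x i = 0}
  zero_mem' := by simp
  add_mem' := by
    intro a b ha hb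
    simp only [Set.mem_ofPred_eq] at ha hb ⊢
    simp [Finset.sum_add_distrib, ha, hb]
  smul_mem' := by
    intro c a ha
    simp only [Set.mem_ofPred_eq] at ha ⊢
    simp [← Finset.mul_sum, ha]

/-- The pairing of `X^*(T)` with the apartment, given by `a_i(η_j) = δ_{ij}`. -/
def charPairing {n : ℕ} (x : Apartment n) : CharLattice n →+ ℝ :=
  QuotientAddGroup.lift _
    { toFun := fun m => ∑ i, (m i : ℝ) * x.1 i
      map_zero' := by simp
      map_add' := fun a b => by simp [add_mul, Finset.sum_add_distrib] }
    (by
      rw [AddSubgroup.zmultiples_le]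
      have hx : ∑ i, x.1 i = 0 := x.2
      change ∑ i, (((1 : ℤ) : ℝ)) * x.1 i = 0
      simpa using hx)

/-- The tropical torus `𝕋^{n-1} = ℝ^n / ℝ(1, …, 1)`. -/
abbrev TropicalTorus (n : ℕ) : Type :=
  (Fin n → ℝ) ⧸ Submodule.span ℝ {(fun _ => 1 : Fin n → ℝ)}

/-- The quotient map `ℝ^n → 𝕋^{n-1}`. -/
def toTropicalTorus (n : ℕ) : (Fin n → ℝ) →ₗ[ℝ] TropicalTorus n := Submodule.mkQ _

theorem apartment_bijective (n : ℕ) :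
    Function.Bijective ((toTropicalTorus n).comp (Apartment n).subtype) := by
  constructor
  · rw [← LinearMap.ker_eq_bot, LinearMap.ker_eq_bot']
    rintro ⟨x, hx⟩ h
    have h' : x ∈ Submodule.span ℝ {(fun _ => 1 : Fin n → ℝ)} := by
      simpa [toTropicalTorus] using h
    obtain ⟨a, rfl⟩ := Submodule.mem_span_singleton.mp h'
    have hx' : ∑ i : Fin n, (a • (fun _ => 1 : Fin n → ℝ)) i = 0 := hx
    ext i
    have hn : (n : ℝ) ≠ 0 := by
      have : 0 < n := i.pos
      positivity
    simp at hx'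
    have : a = 0 := by
      rcases hx' with h0 | h0
      · subst h0; exact i.elim0
      · exact h0
    simp [this]
  · intro y
    obtain ⟨x, rfl⟩ := Submodule.mkQ_surjective _ y
    refine ⟨⟨x - ((∑ i, x i) / n) • (fun _ => 1 : Fin n → ℝ), ?_⟩, ?_⟩
    · change ∑ i, (x - ((∑ i, x i) / n) • (fun _ => 1 : Fin n → ℝ)) i = 0
      rcases Nat.eq_zero_or_pos n with h | h
      · subst h; simp
      · have hn : (n : ℝ) ≠ 0 := by positivity
        simp [Finset.sum_sub_distrib]
        field_simp
        simp
    · change toTropicalTorus n _ = toTropicalTorus n x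
      rw [← sub_eq_zero, ← map_sub]
      simp [toTropicalTorus, Submodule.mem_span_singleton_self]

/-- The identification `A ≃ 𝕋^{n-1}` sending `η_1, …, η_n` to the canonical basis. -/
def apartmentEquiv (n : ℕ) : Apartment n ≃ₗ[ℝ] TropicalTorus n :=
  LinearEquiv.ofBijective _ (apartment_bijective n)

/-! ## The fan of a representation -/

/-- `F` is a non-empty face of the polyhedron `C`: the non-empty set of points of `C` where some
linear functional attains its maximum on `C` (the zero functional gives `C` itself). -/
def IsFace {E : Type*} [AddCommGroup E] [Module ℝ E] (C F : Set E) : Prop :=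
  F.Nonempty ∧ ∃ l : E →ₗ[ℝ] ℝ, F = {x ∈ C | ∀ y ∈ C, l y ≤ l x}

/-- The cone `{x ∈ A : μ₀(x) ≥ μ(x) for all weights μ of ρ}`. It is `C_Δ(ρ)` when
`μ₀ = μ_0(Δ)`. -/
def weightCone {K V W : Type*} [Field K] [AddCommGroup V] [Module K V] [AddCommGroup W]
    [Module K W] {n : ℕ} (e : Module.Basis (Fin n) K V)
    (ρ : Representation K (SpecialLinearGroup K V) W) (μ₀ : CharLattice n) :
    Set (Apartment n) :=
  {x | ∀ μ, IsWeight e ρ μ → charPairing x μ ≤ charPairing x μ₀}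

/-- The fan `F_ρ`: all faces of the cones `C_Δ(ρ)`, where `Δ` runs over the bases of the root
system. -/
def repFan {K V W : Type*} [Field K] [AddCommGroup V] [Module K V] [AddCommGroup W]
    [Module K W] {n : ℕ} (e : Module.Basis (Fin n) K V)
    (ρ : Representation K (SpecialLinearGroup K V) W) : Set (Set (Apartment n)) :=
  {F | ∃ (Δ : Finset (CharLattice n)) (μ₀ : CharLattice n),
    IsRootBasis Δ ∧ IsHighestWeight e ρ Δ μ₀ ∧ IsFace (weightCone e ρ μ₀) F}

/-! ## The polyhedral complex of a polynomial -/

/-- The valuation `v` on `K \ {0}`, normalised by `|x| = exp (-v(x))`. -/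
def val {K : Type*} [NormedField K] (x : K) : ℝ := -Real.log ‖x‖

/-- The extended Newton polytope in `ℝ^{n+1}`: the convex hull of all points
`(-v(c_N), ν_1, …, ν_n)` with `c_N ≠ 0`. -/
def newtonPolytope {K : Type*} [NormedField K] {n : ℕ} (S : MvPolynomial (Fin n) K) :
    Set (Fin (n + 1) → ℝ) :=
  convexHull ℝ {p | ∃ N ∈ S.support,
    p = Fin.cons (-val (S.coeff N)) (fun i => (N i : ℝ))}

/-- The normal cone `N_P(F)`: all `w` such that every point of `F` maximises `⟨w, ·⟩` on `P`. -/
def normalCone {d : ℕ} (P F : Set (Fin d → ℝ)) : Set (Fin d → ℝ) :=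
  {w | F ⊆ {x ∈ P | ∀ y ∈ P, w ⬝ᵥ y ≤ w ⬝ᵥ x}}

/-- The polyhedral complex `C(S)` in `ℝ^n`: the collection of all cells
`N_P(F) ∩ {w_0 = -1}`, where `P` is the extended Newton polytope of `S`, where `F` runs over the
non-empty faces of `P`, and where `{w_0 = -1}` is identified with `ℝ^n`. -/
def tropComplex {K : Type*} [NormedField K] {n : ℕ} (S : MvPolynomial (Fin n) K) :
    Set (Set (Fin n → ℝ)) :=
  {D | ∃ F, IsFace (newtonPolytope S) F ∧
    D = {x | (Fin.cons (-1) x : Fin (n + 1) → ℝ) ∈ normalCone (newtonPolytope S) F}}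

end

end TropicalSchur

/-!
The fan and the tropical complex are both determined by the orbit of `λ` under permutation of
coordinates, and by the same recipe. For `u ∈ ℝⁿ` let the cell of `u` (`orbitCell`) consist of all
`x` that are maximal at every orbit point where `u` is maximal. Both sides of the theorem turn out
to be the collection of all these cells.

Three facts tie the two sides to the orbit.

* The support of `S_λ` contains the orbit (`orbitPoint_mem_support`) and lies in its convex hull
  (`inOrbitHull_of_mem_support`). For a functional with distinct entries each of the two alternants
  has a single monomial of maximal weight, by the rearrangement inequality, and maximal weights add
  up in a product.
* The weights of `𝔖_λ(V)` are classes of points of the hull (`exists_of_isWeight_schurRep`), and the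
  orbit points are weights (`isWeight_schurRep_orbit`). The Young symmetrizer sends a filling of the
  boxes to a combination of rearrangements of fillings without repetitions in the columns, and the
  content of such a filling is dominated by `λ`; on a filling that is constant on rows the
  symmetrizer does not vanish, because the characteristic is zero. Neither the full character
  formula nor weight multiplicities are needed, since only the convex hull enters.
* Each ordering `σ` of the coordinates gives a basis of the root system
  (`isRootBasis_simpleRoots`), whose highest weight is the orbit point sorted by `σ`
  (`isHighestWeight_simpleRoots`). The coefficients are partial sums, so that their signs are
  exactly the dominance order.

The convex geometry needs no separation theorem: the hull is described by support functions, and a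
perturbation argument (`exists_pos_isMaximizer_sub_smul`) identifies the normal cones of the faces
of the Newton polytope, and the faces of the cones of the fan, with cells. When all coefficients
have valuation zero the extended Newton polytope lies in the hyperplane where the first coordinate
vanishes, so that the complex is the normal fan of the ordinary Newton polytope.
-/

namespace TropicalSchur

/-! ### The orbit of a partition and the maximisers of a linear functional on it -/

/-- The point `(λ_{σ 1}, …, λ_{σ n})` of the orbit of `λ` under permutation of coordinates. -/
def orbitPoint {n : ℕ} (lam : Fin n → ℕ) (σ : Equiv.Perm (Fin n)) : Fin n → ℝ :=
  fun i => (lam (σ i) : ℝ)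

/-- The functional `⟨w, ·⟩` takes its maximum on the orbit of `λ` at the point of index `σ`. -/
def IsMaximizer {n : ℕ} (lam : Fin n → ℕ) (w : Fin n → ℝ) (σ : Equiv.Perm (Fin n)) : Prop :=
  ∀ τ, w ⬝ᵥ orbitPoint lam τ ≤ w ⬝ᵥ orbitPoint lam σ

/-- `p` lies in the convex hull of the orbit of `λ`, expressed through support functions: no linear
functional is larger at `p` than on the whole orbit. -/
def InOrbitHull {n : ℕ} (lam : Fin n → ℕ) (p : Fin n → ℝ) : Prop :=
  ∀ w, ∃ σ, w ⬝ᵥ p ≤ w ⬝ᵥ orbitPoint lam σ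

section Orbit

variable {n : ℕ} {lam : Fin n → ℕ}

theorem exists_isMaximizer (lam : Fin n → ℕ) (w : Fin n → ℝ) : ∃ σ, IsMaximizer lam w σ :=
  Finite.exists_max fun σ => w ⬝ᵥ orbitPoint lam σ

theorem InOrbitHull.le {p : Fin n → ℝ} (hp : InOrbitHull lam p) {w : Fin n → ℝ}
    {σ : Equiv.Perm (Fin n)} (hw : IsMaximizer lam w σ) : w ⬝ᵥ p ≤ w ⬝ᵥ orbitPoint lam σ := by
  obtain ⟨τ, hτ⟩ := hp w
  exact hτ.trans (hw τ)

theorem IsMaximizer.eq {w : Fin n → ℝ} {σ τ : Equiv.Perm (Fin n)} (hσ : IsMaximizer lam w σ)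
    (hτ : IsMaximizer lam w τ) : w ⬝ᵥ orbitPoint lam σ = w ⬝ᵥ orbitPoint lam τ :=
  le_antisymm (hτ σ) (hσ τ)

/-- If `y` is maximal wherever `u` is, moving `u` slightly against `y` keeps all maximisers of `u`:
among themselves they still tie, and the other orbit points are strictly below them at `u`. -/
theorem exists_pos_isMaximizer_sub_smul {u y : Fin n → ℝ}
    (h : ∀ σ, IsMaximizer lam u σ → IsMaximizer lam y σ) :
    ∃ ε : ℝ, 0 < ε ∧ ∀ σ, IsMaximizer lam u σ → IsMaximizer lam (u - ε • y) σ := by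
  have key : ∀ᶠ ε in nhdsWithin (0 : ℝ) (Set.Ioi 0), ∀ σ τ, IsMaximizer lam u σ →
      (u - ε • y) ⬝ᵥ orbitPoint lam τ ≤ (u - ε • y) ⬝ᵥ orbitPoint lam σ := by
    refine Filter.eventually_all.2 fun σ => Filter.eventually_all.2 fun τ => ?_
    by_cases hσ : IsMaximizer lam u σ
    swap
    · exact Filter.Eventually.of_forall fun ε h' => absurd h' hσ
    by_cases hτ : IsMaximizer lam u τ
    · refine Filter.Eventually.of_forall fun ε _ => le_of_eq ?_
      simp only [sub_dotProduct, smul_dotProduct, hσ.eq hτ, (h σ hσ).eq (h τ hτ)]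
    · have hlt : u ⬝ᵥ orbitPoint lam τ < u ⬝ᵥ orbitPoint lam σ := by
        refine lt_of_le_of_ne (hσ τ) fun he => hτ fun υ => ?_
        rw [he]
        exact hσ υ
      have hc : ∀ υ, Continuous fun ε : ℝ => (u - ε • y) ⬝ᵥ orbitPoint lam υ := by
        intro υ
        simp only [sub_dotProduct, smul_dotProduct]
        fun_prop
      have := (isOpen_lt (hc τ) (hc σ)).mem_nhds (x := 0) (by simpa using hlt)
      filter_upwards [mem_nhdsWithin_of_mem_nhds this] with ε hε _ using le_of_lt hε
  obtain ⟨ε, hε, hpos⟩ := (key.and self_mem_nhdsWithin).exists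
  exact ⟨ε, hpos, fun σ hσ τ => hε σ τ hσ⟩

/-- A point `p` of the hull at which `u` is maximal lies on the face spanned by the maximisers of
`u` in the orbit; so `p` maximises every `y` that is maximal at all of these. The perturbed
functional `u - ε • y` still has these maximisers, and comparing its value at `p` gives the claim
without any separation theorem. -/
theorem InOrbitHull.le_of_isMaximizer {p : Fin n → ℝ} (hp : InOrbitHull lam p) {u y : Fin n → ℝ}
    (h : ∀ σ, IsMaximizer lam u σ → IsMaximizer lam y σ)
    (hu : ∀ σ, u ⬝ᵥ orbitPoint lam σ ≤ u ⬝ᵥ p) (σ : Equiv.Perm (Fin n)) :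
    y ⬝ᵥ orbitPoint lam σ ≤ y ⬝ᵥ p := by
  obtain ⟨ε, hε, hmax⟩ := exists_pos_isMaximizer_sub_smul h
  obtain ⟨τ, hτ⟩ := exists_isMaximizer lam u
  have h1 := hp.le (hmax τ hτ)
  simp only [sub_dotProduct, smul_dotProduct, smul_eq_mul] at h1
  have h2 : ε * (y ⬝ᵥ orbitPoint lam τ) ≤ ε * (y ⬝ᵥ p) := by linarith [hu τ]
  exact ((h τ hτ) σ).trans (le_of_mul_le_mul_left h2 hε)

theorem exists_antitone_comp (w : Fin n → ℝ) : ∃ σ : Equiv.Perm (Fin n), Antitone (w ∘ σ) := by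
  refine ⟨Tuple.sort (fun i => -w i), fun i j hij => ?_⟩
  have := Tuple.monotone_sort (fun i => -w i) hij
  simpa using this

theorem dotProduct_comp_perm (w p : Fin n → ℝ) (σ : Equiv.Perm (Fin n)) :
    (w ∘ σ) ⬝ᵥ (p ∘ σ) = w ⬝ᵥ p :=
  Equiv.sum_comp σ fun i => w i * p i

theorem isMaximizer_inv_of_antitone (hlam : Antitone lam) {w : Fin n → ℝ}
    {σ : Equiv.Perm (Fin n)} (hw : Antitone (w ∘ σ)) : IsMaximizer lam w σ⁻¹ := by
  intro τ
  rw [← dotProduct_comp_perm w _ σ, ← dotProduct_comp_perm w (orbitPoint lam σ⁻¹) σ]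
  have hmono : Monovary (w ∘ σ) (fun i => (lam i : ℝ)) :=
    hw.monovary fun i j hij => by exact_mod_cast hlam hij
  have := hmono.sum_mul_comp_perm_le_sum_mul (σ := σ.trans τ)
  simpa [dotProduct, orbitPoint, Function.comp_def] using this

/-- For an antitone sequence an initial segment has the largest sum among the sets of its size. -/
theorem sum_le_sum_of_isLowerSet {v : Fin n → ℝ} (hv : Antitone v) {S R : Finset (Fin n)}
    (hS : IsLowerSet (S : Set (Fin n))) (hcard : R.card = S.card) :
    ∑ i ∈ R, v i ≤ ∑ i ∈ S, v i := by
  classical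
  have h1 := Finset.sum_inter_add_sum_sdiff S R v
  have h2 := Finset.sum_inter_add_sum_sdiff R S v
  have hc : (R \ S).card = (S \ R).card := (Finset.card_sdiff_comm hcard)
  rw [Finset.inter_comm] at h2
  suffices ∑ i ∈ R \ S, v i ≤ ∑ i ∈ S \ R, v i by linarith
  let f := Finset.equivOfCardEq hc
  rw [← Finset.sum_coe_sort (R \ S), ← Finset.sum_coe_sort (S \ R), ← f.sum_comp]
  refine Finset.sum_le_sum fun i _ => hv ?_
  have hi := Finset.mem_sdiff.1 i.2
  have hf := Finset.mem_sdiff.1 (f i).2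
  by_contra hlt
  exact hi.2 (hS (not_le.1 hlt).le hf.1)

end Orbit

/-! ### The support of the Schur polynomial -/

section Support

variable {R : Type*} [CommRing R] {n : ℕ}

theorem alternant_eq_sum (m : Fin n → ℕ) :
    alternant R m = ∑ σ : Equiv.Perm (Fin n),
      MvPolynomial.monomial (Finsupp.equivFunOnFinite.symm (m ∘ σ))
        ((Equiv.Perm.sign σ : ℤ) : R) := by
  rw [alternant, Matrix.det_apply']
  refine Finset.sum_congr rfl fun σ _ => ?_
  rw [MvPolynomial.monomial_eq, Finsupp.prod_fintype _ _ (by simp)]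
  simp

theorem exists_perm_of_mem_support_alternant {m : Fin n → ℕ} {N : Fin n →₀ ℕ}
    (hN : N ∈ (alternant R m).support) :
    ∃ σ : Equiv.Perm (Fin n), N = Finsupp.equivFunOnFinite.symm (m ∘ σ) := by
  classical
  rw [MvPolynomial.mem_support_iff, alternant_eq_sum, MvPolynomial.coeff_sum] at hN
  obtain ⟨σ, -, hσ⟩ := Finset.exists_ne_zero_of_sum_ne_zero hN
  rw [MvPolynomial.coeff_monomial] at hσ
  exact ⟨σ, by_contra fun h => hσ (if_neg fun h' => h h'.symm)⟩

theorem mem_support_alternant [Nontrivial R] {m : Fin n → ℕ} (hm : Function.Injective m)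
    (σ : Equiv.Perm (Fin n)) :
    Finsupp.equivFunOnFinite.symm (m ∘ σ) ∈ (alternant R m).support := by
  classical
  rw [MvPolynomial.mem_support_iff, alternant_eq_sum, MvPolynomial.coeff_sum,
    Finset.sum_eq_single σ]
  · rw [MvPolynomial.coeff_monomial, if_pos rfl]
    rcases Int.units_eq_one_or (Equiv.Perm.sign σ) with h | h <;> simp [h]
  · intro τ _ hτ
    rw [MvPolynomial.coeff_monomial, if_neg]
    intro h
    refine hτ (Equiv.ext fun i => hm ?_)
    exact congrFun (Finsupp.equivFunOnFinite.symm.injective h) i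
  · simp

/-- The value of the linear functional `w` at an exponent vector. -/
def weightHom (w : Fin n → ℝ) : (Fin n →₀ ℕ) →+ ℝ where
  toFun N := w ⬝ᵥ fun i => (N i : ℝ)
  map_zero' := by simp [dotProduct]
  map_add' a b := by simp [dotProduct, mul_add, Finset.sum_add_distrib]

/-- If `a₀` is the unique monomial of maximal weight of `f`, then every monomial `c₀` of maximal
weight of `f * g` is `a₀ + b₀` with a monomial `b₀` of maximal weight of `g`. -/
theorem exists_max_support_of_mul [IsDomain R] {f g : MvPolynomial (Fin n) R}
    (φ : (Fin n →₀ ℕ) →+ ℝ) {a₀ c₀ : Fin n →₀ ℕ} (ha₀ : a₀ ∈ f.support)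
    (hf : ∀ a ∈ f.support, φ a ≤ φ a₀ ∧ (φ a = φ a₀ → a = a₀)) (hc₀ : c₀ ∈ (f * g).support)
    (hfg : ∀ c ∈ (f * g).support, φ c ≤ φ c₀) :
    ∃ b₀ ∈ g.support, a₀ + b₀ = c₀ ∧ ∀ b ∈ g.support, φ b ≤ φ b₀ := by
  classical
  have hadd := MvPolynomial.support_mul f g hc₀
  obtain ⟨a, ha, b, hb, rfl⟩ := Finset.mem_add.1 hadd
  obtain ⟨b₁, hb₁, hmax⟩ := Finset.exists_max_image g.support φ ⟨b, hb⟩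
  -- Only the pair `(a₀, b₁)` contributes to the coefficient of `f * g` at `a₀ + b₁`.
  have hmem : a₀ + b₁ ∈ (f * g).support := by
    rw [MvPolynomial.mem_support_iff, MvPolynomial.coeff_mul, Finset.sum_eq_single (a₀, b₁)]
    · exact mul_ne_zero (MvPolynomial.mem_support_iff.1 ha₀) (MvPolynomial.mem_support_iff.1 hb₁)
    · rintro ⟨x, y⟩ hxy hne
      rw [Finset.HasAntidiagonal.mem_antidiagonal] at hxy
      by_contra h
      have hx : x ∈ f.support := MvPolynomial.mem_support_iff.2 (left_ne_zero_of_mul h)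
      have hy : y ∈ g.support := MvPolynomial.mem_support_iff.2 (right_ne_zero_of_mul h)
      have hsum := congrArg φ hxy
      simp only [map_add] at hsum
      have hx0 : x = a₀ := (hf x hx).2 (by linarith [(hf x hx).1, hmax y hy])
      subst hx0
      exact hne (Prod.ext rfl (add_left_cancel hxy))
    · simp
  have hle := hfg _ hmem
  simp only [map_add] at hle
  have h1 := hf a ha
  have h2 := hmax b hb
  have haa : a = a₀ := h1.2 (by linarith)
  subst haa
  exact ⟨b, hb, rfl, fun b' hb' => (hmax b' hb').trans (by linarith)⟩

/-- A strictly decreasing functional has a unique maximiser among the rearrangements of a strictly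
decreasing sequence. -/
theorem weightHom_perm_le {m : Fin n → ℕ} (hm : StrictAnti m) {w : Fin n → ℝ}
    {σ : Equiv.Perm (Fin n)} (hw : StrictAnti (w ∘ σ)) (τ : Equiv.Perm (Fin n)) :
    weightHom w (Finsupp.equivFunOnFinite.symm (m ∘ τ)) ≤
        weightHom w (Finsupp.equivFunOnFinite.symm (m ∘ ⇑σ⁻¹)) ∧
      (weightHom w (Finsupp.equivFunOnFinite.symm (m ∘ τ)) =
        weightHom w (Finsupp.equivFunOnFinite.symm (m ∘ ⇑σ⁻¹)) → m ∘ τ = m ∘ ⇑σ⁻¹) := by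
  refine ⟨isMaximizer_inv_of_antitone hm.antitone hw.antitone τ, fun h => ?_⟩
  have hmono : Monovary (w ∘ σ) (fun i => (m i : ℝ)) :=
    hw.antitone.monovary fun i j hij => by exact_mod_cast hm.antitone hij
  have heq := (hmono.sum_mul_comp_perm_eq_sum_mul_iff (σ := σ.trans τ)).1 (by
    change w ⬝ᵥ orbitPoint m τ = w ⬝ᵥ orbitPoint m σ⁻¹ at h
    rw [← dotProduct_comp_perm w _ σ, ← dotProduct_comp_perm w (orbitPoint m σ⁻¹) σ] at h
    simpa [dotProduct, orbitPoint, Function.comp_def] using h)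
  have hanti : Antitone (m ∘ (σ.trans τ)) := by
    intro i j hij
    rcases hij.eq_or_lt with rfl | hlt
    · exact le_rfl
    · by_contra hcon
      have := heq (i := i) (j := j) (by simpa using not_le.1 hcon)
      exact absurd (hw hlt) (not_lt.2 this)
  have := Tuple.unique_antitone (σ := σ.trans τ) (τ := Equiv.refl _) hanti hm.antitone
  funext i
  simpa using congrFun this (σ⁻¹ i)

variable {K : Type*} [Field K]

theorem strictAnti_add_rev {lam : Fin n → ℕ} (hlam : Antitone lam) :
    StrictAnti fun i : Fin n => lam i + (i.rev : ℕ) :=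
  fun i j hij => by
    have h1 := hlam hij.le
    have h2 : (j.rev : ℕ) < (i.rev : ℕ) := Fin.rev_lt_rev.2 hij
    simp only
    omega

theorem strictAnti_rev : StrictAnti fun i : Fin n => (i.rev : ℕ) := by
  simpa using strictAnti_add_rev (lam := fun _ : Fin n => 0) fun _ _ _ => le_rfl

/-- For a weight `w` sorted strictly by `σ`, both alternants have a unique monomial of maximal
weight, and so their quotient has a monomial of maximal weight `z^(λ ∘ σ⁻¹)`. -/
theorem schurPoly_support_of_strictAnti {lam : Fin n → ℕ} (hlam : Antitone lam) {w : Fin n → ℝ}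
    {σ : Equiv.Perm (Fin n)} (hw : StrictAnti (w ∘ σ)) :
    Finsupp.equivFunOnFinite.symm (lam ∘ ⇑σ⁻¹) ∈ (schurPoly K lam).support ∧
      ∀ N ∈ (schurPoly K lam).support,
        w ⬝ᵥ (fun i => (N i : ℝ)) ≤ w ⬝ᵥ orbitPoint lam σ⁻¹ := by
  obtain ⟨b, hb, hsum, hmax⟩ := exists_max_support_of_mul (R := K) (weightHom w)
    (f := alternant K fun i : Fin n => (i.rev : ℕ)) (g := schurPoly K lam)
    (mem_support_alternant strictAnti_rev.injective σ⁻¹)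
    (by
      intro a ha
      obtain ⟨τ, rfl⟩ := exists_perm_of_mem_support_alternant ha
      have := weightHom_perm_le strictAnti_rev hw τ
      exact ⟨this.1, fun h => congrArg _ (this.2 h)⟩)
    (c₀ := Finsupp.equivFunOnFinite.symm ((fun i : Fin n => lam i + (i.rev : ℕ)) ∘ ⇑σ⁻¹))
    (by
      rw [← schurPoly_spec]
      exact mem_support_alternant (strictAnti_add_rev hlam).injective σ⁻¹)
    (by
      intro c hc
      rw [← schurPoly_spec] at hc
      obtain ⟨τ, rfl⟩ := exists_perm_of_mem_support_alternant hc
      exact (weightHom_perm_le (strictAnti_add_rev hlam) hw τ).1)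
  have hb' : b = Finsupp.equivFunOnFinite.symm (lam ∘ ⇑σ⁻¹) := by
    ext i
    have := DFunLike.congr_fun hsum i
    simp at this ⊢
    omega
  subst hb'
  exact ⟨hb, hmax⟩

theorem orbitPoint_mem_support {lam : Fin n → ℕ} (hlam : Antitone lam)
    (σ : Equiv.Perm (Fin n)) :
    Finsupp.equivFunOnFinite.symm (lam ∘ σ) ∈ (schurPoly K lam).support := by
  have hw : StrictAnti ((fun i => ((σ i).rev : ℝ)) ∘ ⇑σ⁻¹) := fun i j hij => by
    have : ((j.rev : ℕ) : ℝ) < ((i.rev : ℕ) : ℝ) := by exact_mod_cast strictAnti_rev hij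
    have hinv : ∀ k, σ (σ⁻¹ k) = k := σ.apply_symm_apply
    simpa only [Function.comp_apply, hinv] using this
  simpa using (schurPoly_support_of_strictAnti (K := K) hlam hw).1

/-- The Newton polytope of `S_λ` is contained in the convex hull of the orbit of `λ`. A functional
with repeated entries is a limit of functionals `w + ε • δ` sorted strictly by one permutation. -/
theorem inOrbitHull_of_mem_support {lam : Fin n → ℕ} (hlam : Antitone lam) {N : Fin n →₀ ℕ}
    (hN : N ∈ (schurPoly K lam).support) : InOrbitHull lam fun i => (N i : ℝ) := by
  intro w
  obtain ⟨σ, hσ⟩ := exists_antitone_comp w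
  refine ⟨σ⁻¹, ?_⟩
  let d : Fin n → ℝ := fun i => ((σ⁻¹ i).rev : ℕ)
  have hle : ∀ ε : ℝ, 0 < ε →
      (w + ε • d) ⬝ᵥ (fun i => (N i : ℝ)) ≤ (w + ε • d) ⬝ᵥ orbitPoint lam σ⁻¹ := by
    intro ε hε
    refine (schurPoly_support_of_strictAnti (K := K) hlam (σ := σ) ?_).2 N hN
    intro i j hij
    have h1 := hσ hij.le
    have h2 : ((j.rev : ℕ) : ℝ) < ((i.rev : ℕ) : ℝ) := by exact_mod_cast strictAnti_rev hij
    have hinv : ∀ k, σ⁻¹ (σ k) = k := σ.symm_apply_apply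
    have h3 := mul_lt_mul_of_pos_left h2 hε
    simp only [Function.comp_apply] at h1
    simp only [Function.comp_apply, Pi.add_apply, Pi.smul_apply, smul_eq_mul, d,
      hinv]
    linarith
  have hlim : ∀ p : Fin n → ℝ, Filter.Tendsto (fun ε : ℝ => (w + ε • d) ⬝ᵥ p)
      (nhdsWithin 0 (Set.Ioi 0)) (nhds (w ⬝ᵥ p)) := by
    intro p
    have hc : Continuous fun ε : ℝ => (w + ε • d) ⬝ᵥ p := by
      simp only [add_dotProduct, smul_dotProduct]
      fun_prop
    simpa using (hc.tendsto 0).mono_left nhdsWithin_le_nhds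
  exact le_of_tendsto_of_tendsto (hlim _) (hlim _)
    (Filter.eventually_of_mem self_mem_nhdsWithin fun ε hε => hle ε hε)

end Support

/-! ### Fillings of the Young diagram -/

section Fillings

variable {n : ℕ} {lam : Fin n → ℕ}

theorem Box.ext {b b' : Box lam} (h : b.1 = b'.1) (h' : (b.2 : ℕ) = b'.2) : b = b' := by
  obtain ⟨i, k⟩ := b
  obtain ⟨i', k'⟩ := b'
  obtain rfl : i = i' := h
  rw [show k = k' from Fin.ext h']

/-- The content of a filling of the boxes of `λ`: how often each entry occurs. -/
def content (T : Box lam → Fin n) (i : Fin n) : ℕ := (Finset.univ.filter fun b => T b = i).card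

theorem content_comp_perm (T : Box lam → Fin n) (s : Equiv.Perm (Box lam)) :
    content (T ∘ s) = content T := by
  funext i
  refine Finset.card_equiv s fun b => ?_
  simp

theorem prod_eq_prod_pow_content {M : Type*} [CommMonoid M] (f : Fin n → M)
    (T : Box lam → Fin n) : ∏ b, f (T b) = ∏ i, f i ^ content T i := by
  rw [← Finset.prod_fiberwise Finset.univ T]
  refine Finset.prod_congr rfl fun i _ => ?_
  rw [Finset.prod_congr rfl (g := fun _ => f i), Finset.prod_const, content]
  intro b hb
  rw [(Finset.mem_filter.1 hb).2]

theorem sum_eq_dotProduct_content (w : Fin n → ℝ) (T : Box lam → Fin n) :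
    ∑ b, w (T b) = w ⬝ᵥ fun i => (content T i : ℝ) := by
  rw [← Finset.sum_fiberwise Finset.univ T, dotProduct]
  refine Finset.sum_congr rfl fun i _ => ?_
  rw [Finset.sum_congr rfl (g := fun _ => w i), Finset.sum_const, content, nsmul_eq_mul, mul_comm]
  intro b hb
  rw [(Finset.mem_filter.1 hb).2]

theorem content_row (σ : Equiv.Perm (Fin n)) (i : Fin n) :
    content (fun b : Box lam => σ b.1) i = lam (σ⁻¹ i) := by
  obtain ⟨k, rfl⟩ := σ.surjective i
  rw [show σ⁻¹ (σ k) = k from σ.symm_apply_apply k, content, ← Fintype.card_fin (lam k),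
    ← Finset.card_univ]
  symm
  refine Finset.card_bij (fun j _ => ⟨k, j⟩) ?_ ?_ ?_
  · intro j _
    simp
  · intro j _ j' _ h
    simpa using h
  · rintro ⟨k', j⟩ hb
    obtain rfl : k' = k := σ.injective (Finset.mem_filter.1 hb).2
    exact ⟨j, Finset.mem_univ _, rfl⟩

/-- A filling without repetitions in the columns has its content in the hull of the orbit of `λ`:
the entries of each column weigh at most as much as the heaviest letters, one for each box. -/
theorem inOrbitHull_content (hlam : Antitone lam) {T : Box lam → Fin n}
    (hT : ∀ b b' : Box lam, (b.2 : ℕ) = b'.2 → T b = T b' → b = b') :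
    InOrbitHull lam fun i => (content T i : ℝ) := by
  classical
  intro w
  obtain ⟨σ, hσ⟩ := exists_antitone_comp w
  refine ⟨σ⁻¹, ?_⟩
  have hrow : (fun i => (content (fun b : Box lam => σ b.1) i : ℝ)) = orbitPoint lam σ⁻¹ := by
    funext i
    rw [content_row, orbitPoint]
  rw [← hrow, ← sum_eq_dotProduct_content, ← sum_eq_dotProduct_content]
  let c : Box lam → ℕ := fun b => b.2
  have hc : ∀ b ∈ (Finset.univ : Finset (Box lam)), c b ∈ Finset.univ.image c :=
    fun b hb => Finset.mem_image_of_mem c hb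
  rw [← Finset.sum_fiberwise_of_maps_to hc, ← Finset.sum_fiberwise_of_maps_to hc]
  refine Finset.sum_le_sum fun j _ => ?_
  have hmem : ∀ b : Box lam, b ∈ Finset.univ.filter (fun b => c b = j) ↔ (b.2 : ℕ) = j := by
    intro b
    simp [c]
  have hinj : Set.InjOn (fun b : Box lam => b.1) (Finset.univ.filter fun b => c b = j) := by
    rintro ⟨i, k⟩ hb ⟨i', k'⟩ hb' h
    exact Box.ext h (((hmem _).1 hb).trans ((hmem _).1 hb').symm)
  have hinj' : Set.InjOn (fun b : Box lam => σ⁻¹ (T b)) (Finset.univ.filter fun b => c b = j) := by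
    intro b hb b' hb' h
    exact hT b b' (((hmem _).1 hb).trans ((hmem _).1 hb').symm) (σ⁻¹.injective h)
  have hlow : IsLowerSet (((Finset.univ.filter fun b : Box lam => c b = j).image
      fun b => b.1 : Finset (Fin n)) : Set (Fin n)) := by
    intro i i' hi' hi
    rw [Finset.mem_coe, Finset.mem_image] at hi ⊢
    obtain ⟨b, hb, rfl⟩ := hi
    have h1 := (hmem _).1 hb
    exact ⟨⟨i', ⟨j, (h1 ▸ b.2.2).trans_le (hlam hi')⟩⟩, (hmem _).2 rfl, rfl⟩
  have := sum_le_sum_of_isLowerSet hσ hlow (R := (Finset.univ.filter fun b : Box lam => c b = j).image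
      fun b => σ⁻¹ (T b)) (by rw [Finset.card_image_of_injOn hinj, Finset.card_image_of_injOn hinj'])
  rw [Finset.sum_image hinj, Finset.sum_image hinj'] at this
  refine le_trans (le_of_eq (Finset.sum_congr rfl fun b _ => ?_)) this
  have hk : ∀ k, σ (σ⁻¹ k) = k := σ.apply_symm_apply
  simp only [Function.comp_apply, hk]

end Fillings

/-! ### Characters of the torus -/

section Characters

variable {K : Type*} [Field K] {n : ℕ}

theorem charEval_charMk (t : Torus K n) (m : Fin n → ℤ) :
    (charEval t (charMk m)).toMul = ∏ i, t.1 i ^ m i := rfl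

/-- In characteristic zero `2` has infinite order, so the points of the torus with entries `2`,
`2⁻¹` and `1` already separate the characters. -/
theorem charEval_injective [CharZero K] {μ ν : CharLattice n}
    (h : ∀ t : Torus K n, charEval t μ = charEval t ν) : μ = ν := by
  rw [← sub_eq_zero]
  replace h : ∀ t : Torus K n, charEval t (μ - ν) = 0 := fun t => by rw [map_sub, h t, sub_self]
  generalize μ - ν = κ at h ⊢
  induction κ using QuotientAddGroup.induction_on with | H m => ?_
  let u : Kˣ := Units.mk0 2 two_ne_zero
  have hu : ∀ a b : ℤ, u ^ a = u ^ b → a = b := by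
    intro a b hab
    have h1 : ((2 : ℚ) : K) ^ a = ((2 : ℚ) : K) ^ b := by
      simpa [u] using congrArg (Units.val) hab
    rw [← Rat.cast_zpow, ← Rat.cast_zpow, Rat.cast_inj] at h1
    exact zpow_right_injective₀ (by norm_num) (by norm_num) h1
  have hpow : ∀ (i : Fin n) (x : Kˣ), ∏ k, (Pi.mulSingle i x : Fin n → Kˣ) k ^ m k = x ^ m i := by
    intro i x
    rw [Finset.prod_eq_single i]
    · simp
    · intro k _ hk
      simp [Pi.mulSingle_eq_of_ne hk]
    · simp
  have hm : ∀ i j, m i = m j := by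
    intro i j
    let t : Torus K n := ⟨Pi.mulSingle i u * Pi.mulSingle j u⁻¹, by
      simp [Finset.prod_mul_distrib]⟩
    have ht : ∏ k, t.1 k ^ m k = 1 := congrArg Additive.toMul (h t)
    simp only [t, Pi.mul_apply, mul_zpow, Finset.prod_mul_distrib, hpow, inv_zpow] at ht
    exact hu _ _ (mul_inv_eq_one.1 ht)
  refine (QuotientAddGroup.eq_zero_iff m).2 ?_
  rcases Nat.eq_zero_or_pos n with rfl | hn
  · exact AddSubgroup.mem_zmultiples_iff.2 ⟨0, Subsingleton.elim _ _⟩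
  · refine AddSubgroup.mem_zmultiples_iff.2 ⟨m ⟨0, hn⟩, ?_⟩
    funext i
    simp [hm i ⟨0, hn⟩]

end Characters

/-! ### The weights of the Schur module -/

section Weights

variable {K V : Type*} [Field K] [AddCommGroup V] [Module K V] {n : ℕ}
variable (e : Module.Basis (Fin n) K V) (lam : Fin n → ℕ)

/-- The basis of the tensor power indexed by fillings of the boxes of `λ`. -/
noncomputable def tensorBasis : Module.Basis (Box lam → Fin n) K (TensorPower K V lam) :=
  Basis.piTensorProduct fun _ => e

variable {lam}

theorem permAct_tensorBasis (s : Equiv.Perm (Box lam)) (T : Box lam → Fin n) :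
    permAct K V lam s (tensorBasis e lam T) = tensorBasis e lam (T ∘ s.symm) := by
  simp only [tensorBasis, Basis.piTensorProduct_apply, permAct]
  exact PiTensorProduct.reindex_tprod s fun b => e (T b)

theorem tensorRep_tensorBasis (t : Torus K n) (T : Box lam → Fin n) :
    tensorRep K V lam (torusElt e t) (tensorBasis e lam T) =
      ((charEval t (charMk fun i => (content T i : ℤ))).toMul : K) • tensorBasis e lam T := by
  rw [charEval_charMk]
  simp only [zpow_natCast]
  rw [← prod_eq_prod_pow_content, Units.coe_prod]
  simp only [tensorBasis, Basis.piTensorProduct_apply]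
  rw [← MultilinearMap.map_smul_univ]
  refine (PiTensorProduct.map_tprod _ _).trans ?_
  congr 1
  funext b
  exact torusElt_apply e t (T b)

theorem repr_tensorRep (t : Torus K n) (x : TensorPower K V lam) (T : Box lam → Fin n) :
    (tensorBasis e lam).repr (tensorRep K V lam (torusElt e t) x) T =
      ((charEval t (charMk fun i => (content T i : ℤ))).toMul : K) *
        (tensorBasis e lam).repr x T := by
  classical
  have : (tensorBasis e lam).coord T ∘ₗ tensorRep K V lam (torusElt e t) =
      ((charEval t (charMk fun i => (content T i : ℤ))).toMul : K) •
        (tensorBasis e lam).coord T := by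
    refine (tensorBasis e lam).ext fun U => ?_
    simp only [LinearMap.comp_apply, LinearMap.smul_apply, tensorRep_tensorBasis, map_smul,
      Module.Basis.coord_apply, Module.Basis.repr_self, smul_eq_mul]
    by_cases h : U = T
    · rw [h]
    · simp [h]
  exact LinearMap.congr_fun this x

theorem colAntisymmetrizer_tensorBasis_eq_zero {T : Box lam → Fin n} {b b' : Box lam}
    (hcol : (b.2 : ℕ) = b'.2) (hT : T b = T b') (hne : b ≠ b') :
    colAntisymmetrizer K V lam (tensorBasis e lam T) = 0 := by
  classical
  simp only [colAntisymmetrizer, LinearMap.sum_apply, LinearMap.smul_apply, permAct_tensorBasis]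
  have hswap : T ∘ (Equiv.swap b b') = T := by
    funext x
    rcases eq_or_ne x b with rfl | h1
    · simp [hT]
    rcases eq_or_ne x b' with rfl | h2
    · simp [hT]
    simp [Equiv.swap_apply_of_ne_of_ne h1 h2]
  -- The terms of `s` and `s * (b b')` cancel.
  refine Finset.sum_involution (fun s _ => s * Equiv.swap b b') ?_ ?_ ?_ ?_
  · intro s _
    have : T ∘ ⇑(s * Equiv.swap b b').symm = T ∘ ⇑s.symm := by
      conv_rhs => rw [← hswap]
      rfl
    rw [this, Equiv.Perm.sign_mul, Equiv.Perm.sign_swap hne]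
    simp
  · intro s _ _ h
    exact hne (Equiv.swap_eq_one_iff.1 (mul_eq_left.1 h))
  · intro s hs
    simp only [Finset.mem_filter, Finset.mem_univ, true_and, Equiv.Perm.coe_mul,
      Function.comp_apply] at hs ⊢
    intro x
    rw [hs]
    rcases eq_or_ne x b with rfl | h1
    · rw [Equiv.swap_apply_left, hcol]
    rcases eq_or_ne x b' with rfl | h2
    · rw [Equiv.swap_apply_right, hcol]
    rw [Equiv.swap_apply_of_ne_of_ne h1 h2]
  · intro s _
    simp [mul_assoc]

/-- Every filling occurring in an element of the Schur module is a rearrangement of one without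
repetitions in the columns. -/
theorem inOrbitHull_content_of_repr_ne_zero (hlam : Antitone lam) {x : TensorPower K V lam}
    {T : Box lam → Fin n} (h : (tensorBasis e lam).repr (youngSymmetrizer K V lam x) T ≠ 0) :
    InOrbitHull lam fun i => (content T i : ℝ) := by
  classical
  rw [← (tensorBasis e lam).sum_repr x, map_sum, map_sum, Finsupp.finsetSum_apply] at h
  obtain ⟨T', -, h⟩ := Finset.exists_ne_zero_of_sum_ne_zero h
  rw [map_smul, map_smul, Finsupp.smul_apply, smul_eq_mul] at h
  replace h := right_ne_zero_of_mul h
  simp only [youngSymmetrizer, LinearMap.comp_apply, rowSymmetrizer, LinearMap.sum_apply, map_sum,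
    permAct_tensorBasis, Finsupp.finsetSum_apply] at h
  obtain ⟨r, -, h⟩ := Finset.exists_ne_zero_of_sum_ne_zero h
  generalize T' ∘ r.symm = U at h
  have hU : ∀ b b' : Box lam, (b.2 : ℕ) = b'.2 → U b = U b' → b = b' := by
    intro b b' hc hb
    by_contra hne
    rw [colAntisymmetrizer_tensorBasis_eq_zero e hc hb hne] at h
    simp at h
  have hhull := inOrbitHull_content hlam hU
  simp only [colAntisymmetrizer, LinearMap.sum_apply, LinearMap.smul_apply, map_sum,
    permAct_tensorBasis, Finsupp.finsetSum_apply, map_smul, Finsupp.smul_apply, smul_eq_mul] at h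
  obtain ⟨s, -, h⟩ := Finset.exists_ne_zero_of_sum_ne_zero h
  replace h := right_ne_zero_of_mul h
  rw [Module.Basis.repr_self, Finsupp.single_apply_ne_zero] at h
  rwa [h.1, content_comp_perm]

/-- The filling constant on rows is fixed by the row group and by no non-trivial element of the
column group, so the Young symmetrizer multiplies its coefficient by the order of the row group. -/
theorem youngSymmetrizer_row_ne_zero [CharZero K] (σ : Equiv.Perm (Fin n)) :
    youngSymmetrizer K V lam (tensorBasis e lam fun b => σ b.1) ≠ 0 := by
  classical
  set T : Box lam → Fin n := fun b => σ b.1 with hT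
  have hrow : rowSymmetrizer K V lam (tensorBasis e lam T) =
      (((Finset.univ.filter fun s : Equiv.Perm (Box lam) => ∀ b, (s b).1 = b.1).card : ℕ) : K) •
        tensorBasis e lam T := by
    rw [rowSymmetrizer, LinearMap.sum_apply, Finset.sum_congr rfl (g := fun _ => tensorBasis e lam T),
      Finset.sum_const, Nat.cast_smul_eq_nsmul]
    intro s hs
    rw [permAct_tensorBasis]
    congr 1
    funext b
    have := (Finset.mem_filter.1 hs).2 (s.symm b)
    simp only [Equiv.apply_symm_apply] at this
    simp [hT, this]
  have hcol : (tensorBasis e lam).repr (colAntisymmetrizer K V lam (tensorBasis e lam T)) T = 1 := by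
    simp only [colAntisymmetrizer, LinearMap.sum_apply, LinearMap.smul_apply, map_sum,
      permAct_tensorBasis, Finsupp.finsetSum_apply, map_smul, Finsupp.smul_apply, smul_eq_mul,
      Module.Basis.repr_self]
    rw [Finset.sum_eq_single 1]
    · rw [Finsupp.single_apply, if_pos]
      · simp
      · rfl
    · intro s hs hne
      rw [Finsupp.single_apply, if_neg, mul_zero]
      intro h
      refine hne (Equiv.ext fun b => ?_)
      have h1 := congrFun h (s b)
      simp only [hT, Function.comp_apply, Equiv.symm_apply_apply] at h1
      have h1 : b.1 = (s b).1 := σ.injective h1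
      have h2 : ((s b).2 : ℕ) = b.2 := (Finset.mem_filter.1 hs).2 b
      exact Box.ext h1.symm h2
    · intro h
      simp at h
  intro h
  rw [youngSymmetrizer, LinearMap.comp_apply, hrow, map_smul] at h
  have h3 := congrArg (fun x => (tensorBasis e lam).repr x T) h
  simp only [map_smul, Finsupp.smul_apply, hcol, map_zero, Finsupp.zero_apply, smul_eq_mul,
    mul_one, Nat.cast_eq_zero, Finset.card_eq_zero] at h3
  have : (1 : Equiv.Perm (Box lam)) ∈ (∅ : Finset (Equiv.Perm (Box lam))) := by
    rw [← h3]
    simp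
  simp at this

theorem isWeight_schurRep_orbit [CharZero K] (σ : Equiv.Perm (Fin n)) :
    IsWeight e (schurRep K V lam) (charMk fun i => (lam (σ i) : ℤ)) := by
  refine ⟨⟨youngSymmetrizer K V lam (tensorBasis e lam fun b => σ⁻¹ b.1), ⟨_, rfl⟩⟩, fun t => ?_,
    fun h => youngSymmetrizer_row_ne_zero e σ⁻¹ (congrArg Subtype.val h)⟩
  apply Subtype.ext
  change tensorRep K V lam (torusElt e t) (youngSymmetrizer K V lam _) = _ • _
  rw [tensorRep_youngSymmetrizer, tensorRep_tensorBasis, map_smul]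
  simp only [content_row, inv_inv]

theorem exists_of_isWeight_schurRep [CharZero K] (hlam : Antitone lam) {μ : CharLattice n}
    (hμ : IsWeight e (schurRep K V lam) μ) :
    ∃ N : Fin n → ℕ, μ = charMk (fun i => (N i : ℤ)) ∧ InOrbitHull lam fun i => (N i : ℝ) := by
  obtain ⟨⟨_, ⟨x, rfl⟩⟩, hw, hne⟩ := hμ
  have hne' : (tensorBasis e lam).repr (youngSymmetrizer K V lam x) ≠ 0 := fun h =>
    hne (Subtype.ext ((tensorBasis e lam).repr.map_eq_zero_iff.1 h))
  obtain ⟨T, hT⟩ := Finsupp.ne_iff.1 hne'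
  rw [Finsupp.zero_apply] at hT
  refine ⟨content T, charEval_injective (K := K) fun t => ?_,
    inOrbitHull_content_of_repr_ne_zero e hlam hT⟩
  have h1 : tensorRep K V lam (torusElt e t) (youngSymmetrizer K V lam x) =
      ((charEval t μ).toMul : K) • youngSymmetrizer K V lam x := congrArg Subtype.val (hw t)
  have h2 := repr_tensorRep e t (youngSymmetrizer K V lam x) T
  rw [h1, map_smul, Finsupp.smul_apply, smul_eq_mul] at h2
  exact Additive.toMul.injective (Units.ext (mul_right_cancel₀ hT h2))

theorem IsWeight.of_equiv {W W' : Type*} [AddCommGroup W] [Module K W] [AddCommGroup W']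
    [Module K W'] {ρ : Representation K (SpecialLinearGroup K V) W}
    {ρ' : Representation K (SpecialLinearGroup K V) W'} (φ : ρ.Equiv ρ') {μ : CharLattice n}
    (h : IsWeight e ρ μ) : IsWeight e ρ' μ := by
  obtain ⟨w, hw, hne⟩ := h
  refine ⟨φ.toLinearEquiv w, fun t => ?_, fun h0 => hne (φ.toLinearEquiv.map_eq_zero_iff.1 h0)⟩
  have h1 : φ.toLinearEquiv (ρ (torusElt e t) w) = ρ' (torusElt e t) (φ.toLinearEquiv w) :=
    LinearMap.congr_fun (φ.toIntertwiningMap.isIntertwining' (torusElt e t)) w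
  rw [← h1, hw t, map_smul]

end Weights

/-! ### Bases of the root system and highest weights -/

section RootBases

variable {m : ℕ}

/-- The simple root `a_{σ i} - a_{σ (i + 1)}` attached to an ordering `σ` of the coordinates. -/
def simpleRoot (σ : Equiv.Perm (Fin (m + 1))) (i : Fin m) : CharLattice (m + 1) :=
  charMk (Pi.single (σ i.castSucc) 1 - Pi.single (σ i.succ) 1)

theorem charMk_sum_smul {n : ℕ} {ι : Type*} (s : Finset ι) (c : ι → ℤ) (v : ι → Fin n → ℤ) :
    charMk (∑ i ∈ s, c i • v i) = ∑ i ∈ s, c i • charMk (v i) := by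
  change QuotientAddGroup.mk' _ _ = ∑ i ∈ s, c i • QuotientAddGroup.mk' _ _
  simp

/-- Summation by parts: a vector of sum zero is the combination of the simple roots whose
coefficients are its partial sums. -/
theorem charMk_eq_sum_simpleRoot (σ : Equiv.Perm (Fin (m + 1))) {v : Fin (m + 1) → ℤ}
    (hv : ∑ i, v i = 0) :
    charMk v = ∑ i : Fin m, (∑ j ∈ Finset.Iic i.castSucc, v (σ j)) • simpleRoot σ i := by
  simp only [simpleRoot]
  rw [← charMk_sum_smul]
  congr 1
  funext x
  obtain ⟨k, rfl⟩ := σ.surjective x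
  let p : Fin (m + 1) → ℤ := fun k => ∑ j ∈ Finset.Iic k, v (σ j)
  let q : Fin (m + 1) → ℤ := Fin.cons 0 fun i => p i.castSucc
  have hlast : p (Fin.last m) = 0 := by
    have : Finset.Iic (Fin.last m) = Finset.univ := Finset.eq_univ_of_forall fun k => by
      simpa using Fin.le_last k
    simp only [p, this]
    rw [Equiv.sum_comp σ v, hv]
  have h1 : ∑ i : Fin m, p i.castSucc * (if k = i.castSucc then 1 else 0) = p k := by
    have := Fin.sum_univ_castSucc fun i => p i * (if k = i then 1 else 0)
    simpa [hlast] using this.symm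
  have h2 : ∑ i : Fin m, p i.castSucc * (if k = i.succ then 1 else 0) = q k := by
    have := Fin.sum_univ_succ fun i => q i * (if k = i then 1 else 0)
    simpa [q] using this.symm
  have h3 : p k - q k = v (σ k) := by
    refine Fin.cases ?_ (fun i => ?_) k
    · have : Finset.Iic (0 : Fin (m + 1)) = {0} := by
        ext j
        simp
      simp [p, q, this]
    · have : Finset.Iic i.succ = insert i.succ (Finset.Iic i.castSucc) := by
        ext j
        simp only [Finset.mem_Iic, Finset.mem_insert, Fin.le_def, Fin.ext_iff, Fin.val_succ,
          Fin.val_castSucc]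
        omega
      simp only [p, q, Fin.cons_succ, this]
      rw [Finset.sum_insert (by simp [Fin.le_def])]
      ring
  rw [← h3, ← h1, ← h2, ← Finset.sum_sub_distrib, Finset.sum_apply]
  refine Finset.sum_congr rfl fun i _ => ?_
  simp only [Pi.smul_apply, Pi.sub_apply, Pi.single_apply, smul_eq_mul, mul_sub,
    σ.injective.eq_iff, p]

/-- The partial sums form the dual basis of the simple roots. -/
theorem linearIndependent_simpleRoot (σ : Equiv.Perm (Fin (m + 1))) :
    LinearIndependent ℤ (simpleRoot σ) := by
  rw [Fintype.linearIndependent_iff]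
  intro c hc k
  simp only [simpleRoot] at hc
  rw [← charMk_sum_smul] at hc
  obtain ⟨a, ha⟩ := AddSubgroup.mem_zmultiples_iff.1 ((QuotientAddGroup.eq_zero_iff _).1 hc)
  have hsum : ∑ x, (∑ i : Fin m,
      c i • (Pi.single (σ i.castSucc) 1 - Pi.single (σ i.succ) 1 : Fin (m + 1) → ℤ)) x = 0 := by
    simp only [Finset.sum_apply]
    rw [Finset.sum_comm]
    refine Finset.sum_eq_zero fun i _ => ?_
    simp [← Finset.mul_sum]
  rw [← ha] at hsum
  have ha0 : a = 0 := by
    have : ((m : ℤ) + 1) * a = 0 := by simpa using hsum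
    exact (mul_eq_zero.1 this).resolve_left (by positivity)
  rw [ha0, zero_smul] at ha
  have hk : ∑ j ∈ Finset.Iic k.castSucc, (∑ i : Fin m,
      c i • (Pi.single (σ i.castSucc) 1 - Pi.single (σ i.succ) 1 : Fin (m + 1) → ℤ)) (σ j) = 0 := by
    rw [← ha]
    simp
  simp only [Finset.sum_apply] at hk
  rw [Finset.sum_comm, Finset.sum_eq_single k] at hk
  · simpa [← Finset.mul_sum, Pi.single_apply, Fin.le_def] using hk
  · intro i _ hik
    have : (i : ℕ) ≠ k := fun h => hik (Fin.ext h)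
    simp only [Pi.smul_apply, Pi.sub_apply, Pi.single_apply, smul_eq_mul, ← Finset.mul_sum,
      Finset.sum_sub_distrib, σ.injective.eq_iff, Finset.sum_ite_eq', Finset.mem_Iic, Fin.le_def,
      Fin.val_succ, Fin.val_castSucc]
    split_ifs <;> omega
  · simp

/-- The set of simple roots `a_{σ i} - a_{σ (i + 1)}`. -/
def simpleRoots (σ : Equiv.Perm (Fin (m + 1))) : Finset (CharLattice (m + 1)) :=
  Finset.univ.map ⟨simpleRoot σ, (linearIndependent_simpleRoot σ).injective⟩

theorem sum_simpleRoots {M : Type*} [Semiring M] [Module M (CharLattice (m + 1))]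
    (σ : Equiv.Perm (Fin (m + 1))) (p : Fin m → M) :
    ∑ i, p i • simpleRoot σ i =
      ∑ c ∈ simpleRoots σ, Function.extend (simpleRoot σ) p 0 c • c := by
  rw [simpleRoots, Finset.sum_map]
  refine Finset.sum_congr rfl fun i _ => ?_
  rw [Function.Embedding.coeFn_mk, (linearIndependent_simpleRoot σ).injective.extend_apply]

theorem isRootBasis_simpleRoots (σ : Equiv.Perm (Fin (m + 1))) :
    IsRootBasis (simpleRoots σ) where
  subset := by
    intro c hc
    obtain ⟨i, -, rfl⟩ := Finset.mem_map.1 hc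
    refine ⟨σ i.castSucc, σ i.succ, fun h => ?_, rfl⟩
    exact i.castSucc_lt_succ.ne (σ.injective h)
  linearIndependent := by
    have hmem : ∀ c : simpleRoots σ, ∃ i, simpleRoot σ i = c := fun c => by
      obtain ⟨i, -, hi⟩ := Finset.mem_map.1 c.2
      exact ⟨i, hi⟩
    choose g hg using hmem
    have := (linearIndependent_simpleRoot σ).comp g fun c c' h => Subtype.ext (by
      rw [← hg c, ← hg c', h])
    simpa only [Function.comp_def, hg] using this
  sameSign := by
    rintro _ ⟨i, j, -, rfl⟩
    obtain ⟨i, rfl⟩ := σ.surjective i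
    obtain ⟨j, rfl⟩ := σ.surjective j
    have hsum : ∑ x, (Pi.single (σ i) 1 - Pi.single (σ j) 1 : Fin (m + 1) → ℤ) x = 0 := by simp
    refine ⟨_, (charMk_eq_sum_simpleRoot σ hsum).trans (sum_simpleRoots σ _), ?_⟩
    have hval : ∀ k : Fin m, ∑ l ∈ Finset.Iic k.castSucc,
        (Pi.single (σ i) 1 - Pi.single (σ j) 1 : Fin (m + 1) → ℤ) (σ l) =
        (if i ≤ k.castSucc then 1 else 0) - (if j ≤ k.castSucc then 1 else 0) := by
      intro k
      simp only [Pi.sub_apply, Pi.single_apply, Finset.sum_sub_distrib, σ.injective.eq_iff,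
        Finset.sum_ite_eq', Finset.mem_Iic]
    rcases le_total i j with hij | hij
    · left
      intro c hc
      obtain ⟨k, -, rfl⟩ := Finset.mem_map.1 hc
      rw [Function.Embedding.coeFn_mk, (linearIndependent_simpleRoot σ).injective.extend_apply,
        hval]
      split_ifs with h1 h2
      · simp
      · simp
      · exact absurd (hij.trans ‹_›) h1
      · simp
    · right
      intro c hc
      obtain ⟨k, -, rfl⟩ := Finset.mem_map.1 hc
      rw [Function.Embedding.coeFn_mk, (linearIndependent_simpleRoot σ).injective.extend_apply,
        hval]
      split_ifs with h1 h2 h2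
      · simp
      · exact absurd (hij.trans h1) h2
      · simp
      · simp

theorem InOrbitHull.sum_eq {n : ℕ} {lam : Fin n → ℕ} {N : Fin n → ℕ}
    (hN : InOrbitHull lam fun i => (N i : ℝ)) : ∑ i, N i = ∑ i, lam i := by
  have key : ∀ a : ℝ, a * ∑ i, (N i : ℝ) ≤ a * ∑ i, (lam i : ℝ) := by
    intro a
    obtain ⟨σ, hσ⟩ := hN fun _ => a
    simp only [dotProduct, ← Finset.mul_sum, orbitPoint] at hσ
    rwa [Equiv.sum_comp σ fun i => (lam i : ℝ)] at hσ
  have h1 := key 1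
  have h2 := key (-1)
  have : (∑ i, (N i : ℝ)) = ∑ i, (lam i : ℝ) := by linarith
  exact_mod_cast this

/-- Dominance order: partial sums, in any ordering of the coordinates, are at most those of `λ`. -/
theorem InOrbitHull.sum_Iic_le {n : ℕ} {lam : Fin n → ℕ} (hlam : Antitone lam) {N : Fin n → ℕ}
    (hN : InOrbitHull lam fun i => (N i : ℝ)) (σ : Equiv.Perm (Fin n)) (k : Fin n) :
    ∑ j ∈ Finset.Iic k, N (σ j) ≤ ∑ j ∈ Finset.Iic k, lam j := by
  let w : Fin n → ℝ := fun i => if σ⁻¹ i ≤ k then 1 else 0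
  have hinv : ∀ j, σ⁻¹ (σ j) = j := σ.symm_apply_apply
  have hw : Antitone (w ∘ σ) := by
    intro i j hij
    simp only [w, Function.comp_apply, hinv]
    split_ifs with h1 h2
    · exact le_rfl
    · exact absurd (hij.trans h1) h2
    · exact zero_le_one
    · exact le_rfl
  have hle := hN.le (isMaximizer_inv_of_antitone hlam hw)
  rw [← dotProduct_comp_perm w _ σ, ← dotProduct_comp_perm w (orbitPoint lam σ⁻¹) σ] at hle
  simp only [dotProduct, w, Function.comp_apply, hinv, orbitPoint, ite_mul, one_mul, zero_mul,
    ← Finset.sum_filter] at hle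
  have hfil : (Finset.univ.filter fun j => j ≤ k) = Finset.Iic k := by
    ext j
    simp
  rw [hfil] at hle
  exact_mod_cast hle

/-- The weight `λ ∘ σ⁻¹` is the highest weight for the simple roots of the ordering `σ`, as soon as
it is a weight and all weights lie in the hull of the orbit of `λ`. -/
theorem isHighestWeight_simpleRoots {K V W : Type*} [Field K] [AddCommGroup V] [Module K V]
    [AddCommGroup W] [Module K W] {e : Module.Basis (Fin (m + 1)) K V}
    {ρ : Representation K (SpecialLinearGroup K V) W} {lam : Fin (m + 1) → ℕ}
    (hlam : Antitone lam) (σ : Equiv.Perm (Fin (m + 1)))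
    (hσ : IsWeight e ρ (charMk fun i => (lam (σ⁻¹ i) : ℤ)))
    (hρ : ∀ μ, IsWeight e ρ μ →
      ∃ N : Fin (m + 1) → ℕ, μ = charMk (fun i => (N i : ℤ)) ∧ InOrbitHull lam fun i => (N i : ℝ)) :
    IsHighestWeight e ρ (simpleRoots σ) (charMk fun i => (lam (σ⁻¹ i) : ℤ)) := by
  refine ⟨hσ, fun μ hμ => ?_⟩
  obtain ⟨N, rfl, hN⟩ := hρ μ hμ
  let v : Fin (m + 1) → ℤ := fun i => (lam (σ⁻¹ i) : ℤ) - N i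
  have hv : ∑ i, v i = 0 := by
    simp only [v, Finset.sum_sub_distrib]
    rw [Equiv.sum_comp σ⁻¹ fun i => (lam i : ℤ), sub_eq_zero]
    exact_mod_cast hN.sum_eq.symm
  let p : Fin m → ℕ := fun i =>
    ∑ j ∈ Finset.Iic i.castSucc, lam j - ∑ j ∈ Finset.Iic i.castSucc, N (σ j)
  have hp : ∀ i, ∑ j ∈ Finset.Iic i.castSucc, v (σ j) = (p i : ℤ) := by
    intro i
    have hinv : ∀ j, σ⁻¹ (σ j) = j := σ.symm_apply_apply
    simp only [v, p, hinv, Finset.sum_sub_distrib]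
    rw [Nat.cast_sub (hN.sum_Iic_le hlam σ _)]
    push_cast
    rfl
  refine ⟨Function.extend (simpleRoot σ) p 0, ?_⟩
  rw [← sum_simpleRoots]
  refine (charMk_eq_sum_simpleRoot σ hv).trans (Finset.sum_congr rfl fun i _ => ?_)
  rw [hp, natCast_zsmul]

end RootBases

/-! ### The two collections of cones -/

section Cells

variable {n : ℕ} {lam : Fin n → ℕ}

/-- The cell of a functional `u`: all `x` that are maximal on the orbit of `λ` wherever `u` is. -/
def orbitCell (lam : Fin n → ℕ) (u : Fin n → ℝ) : Set (Fin n → ℝ) :=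
  {x | ∀ σ, IsMaximizer lam u σ → IsMaximizer lam x σ}

theorem isMaximizer_congr {x y : Fin n → ℝ} (h : toTropicalTorus n x = toTropicalTorus n y)
    (σ : Equiv.Perm (Fin n)) : IsMaximizer lam x σ ↔ IsMaximizer lam y σ := by
  obtain ⟨a, ha⟩ := Submodule.mem_span_singleton.1 ((Submodule.Quotient.eq _).1 h)
  have hx : x = y + a • fun _ => 1 := by rw [ha]; simp
  have hsum : ∀ τ, ∑ i, orbitPoint lam τ i = ∑ i, (lam i : ℝ) :=
    fun τ => Equiv.sum_comp τ fun i => (lam i : ℝ)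
  have hdot : ∀ τ, x ⬝ᵥ orbitPoint lam τ = y ⬝ᵥ orbitPoint lam τ + a * ∑ i, (lam i : ℝ) := by
    intro τ
    rw [hx, add_dotProduct, smul_dotProduct, ← hsum τ]
    simp [dotProduct]
  simp only [IsMaximizer, hdot, add_le_add_iff_right]

theorem orbitCell_congr {u v : Fin n → ℝ} (h : toTropicalTorus n u = toTropicalTorus n v) :
    orbitCell lam u = orbitCell lam v := by
  ext x
  simp only [orbitCell, Set.mem_ofPred_eq, isMaximizer_congr h]

/-- Cells are invariant under translation by `(1, …, 1)`, because all orbit points have the same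
coordinate sum. -/
theorem apartmentEquiv_image_orbitCell (u : Fin n → ℝ) :
    apartmentEquiv n '' {x | x.1 ∈ orbitCell lam u} = toTropicalTorus n '' orbitCell lam u := by
  ext z
  constructor
  · rintro ⟨x, hx, rfl⟩
    exact ⟨x.1, hx, rfl⟩
  · rintro ⟨y, hy, rfl⟩
    obtain ⟨x, hx⟩ := (apartmentEquiv n).surjective (toTropicalTorus n y)
    exact ⟨x, fun σ hσ => (isMaximizer_congr hx σ).2 (hy σ hσ), hx⟩

theorem convex_inOrbitHull : Convex ℝ {p | InOrbitHull lam p} := by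
  intro p hp q hq a b ha hb hab w
  obtain ⟨σ, hσ⟩ := exists_isMaximizer lam w
  refine ⟨σ, ?_⟩
  have h1 := mul_le_mul_of_nonneg_left (InOrbitHull.le hp hσ) ha
  have h2 := mul_le_mul_of_nonneg_left (InOrbitHull.le hq hσ) hb
  rw [dotProduct_add, dotProduct_smul, dotProduct_smul, smul_eq_mul, smul_eq_mul]
  calc _ ≤ a * (w ⬝ᵥ orbitPoint lam σ) + b * (w ⬝ᵥ orbitPoint lam σ) := add_le_add h1 h2
    _ = _ := by rw [← add_mul, hab, one_mul]

/-! ### The polyhedral complex of the Schur polynomial -/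

section Newton

variable {K : Type*} [NontriviallyNormedField K]

theorem cons_orbitPoint_mem_newtonPolytope (hlam : Antitone lam)
    (hval : ∀ N ∈ (schurPoly K lam).support, val ((schurPoly K lam).coeff N) = 0)
    (σ : Equiv.Perm (Fin n)) :
    (Fin.cons 0 (orbitPoint lam σ) : Fin (n + 1) → ℝ) ∈ newtonPolytope (schurPoly K lam) := by
  have hmem := orbitPoint_mem_support (K := K) hlam σ
  refine subset_convexHull ℝ _ ⟨_, hmem, ?_⟩
  rw [hval _ hmem, neg_zero]
  rfl

theorem of_mem_newtonPolytope (hlam : Antitone lam)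
    (hval : ∀ N ∈ (schurPoly K lam).support, val ((schurPoly K lam).coeff N) = 0)
    {y : Fin (n + 1) → ℝ} (hy : y ∈ newtonPolytope (schurPoly K lam)) :
    y 0 = 0 ∧ InOrbitHull lam (Fin.tail y) := by
  have hconv : Convex ℝ {y : Fin (n + 1) → ℝ | y 0 = 0 ∧ InOrbitHull lam (Fin.tail y)} := by
    intro p hp q hq a b ha hb hab
    exact ⟨by simp [hp.1, hq.1], convex_inOrbitHull hp.2 hq.2 ha hb hab⟩
  refine convexHull_min ?_ hconv hy
  rintro _ ⟨N, hN, rfl⟩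
  refine ⟨by simp [hval N hN], ?_⟩
  simpa using inOrbitHull_of_mem_support hlam hN

theorem cons_dotProduct (a : ℝ) (x : Fin n → ℝ) (y : Fin (n + 1) → ℝ) :
    (Fin.cons a x : Fin (n + 1) → ℝ) ⬝ᵥ y = a * y 0 + x ⬝ᵥ Fin.tail y := by
  simp [dotProduct, Fin.sum_univ_succ, Fin.tail]

/-- The cell of the complex attached to the face of the Newton polytope cut out by `u`. -/
theorem normalCone_face_newtonPolytope (hlam : Antitone lam)
    (hval : ∀ N ∈ (schurPoly K lam).support, val ((schurPoly K lam).coeff N) = 0)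
    (u : Fin n → ℝ) :
    {x : Fin n → ℝ | (Fin.cons (-1) x : Fin (n + 1) → ℝ) ∈ normalCone
      (newtonPolytope (schurPoly K lam)) {p ∈ newtonPolytope (schurPoly K lam) |
        ∀ y ∈ newtonPolytope (schurPoly K lam), u ⬝ᵥ Fin.tail y ≤ u ⬝ᵥ Fin.tail p}} =
      orbitCell lam u := by
  have hP := fun y => of_mem_newtonPolytope hlam hval (y := y)
  have horb := cons_orbitPoint_mem_newtonPolytope (K := K) hlam hval
  ext x
  constructor
  · intro hx σ hσ τ
    have hface := hx ⟨horb σ, fun y hy => by simpa using (hP y hy).2.le hσ⟩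
    simpa [cons_dotProduct] using hface.2 _ (horb τ)
  · rintro hx p ⟨hp, hmax⟩
    refine ⟨hp, fun y hy => ?_⟩
    rw [cons_dotProduct, cons_dotProduct, (hP y hy).1, (hP p hp).1]
    obtain ⟨τ, hτ⟩ := (hP y hy).2 x
    have := (hP p hp).2.le_of_isMaximizer hx (fun σ => by simpa using hmax _ (horb σ)) τ
    linarith

theorem tropComplex_schurPoly (hlam : Antitone lam)
    (hval : ∀ N ∈ (schurPoly K lam).support, val ((schurPoly K lam).coeff N) = 0) :
    tropComplex (schurPoly K lam) = Set.range (orbitCell lam) := by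
  have hP := fun y => of_mem_newtonPolytope hlam hval (y := y)
  ext D
  constructor
  · rintro ⟨F, ⟨-, l, rfl⟩, rfl⟩
    refine ⟨fun i => l (Pi.single i.succ 1), ?_⟩
    have hl : ∀ y ∈ newtonPolytope (schurPoly K lam),
        l y = (fun i : Fin n => l (Pi.single i.succ 1)) ⬝ᵥ Fin.tail y := by
      intro y hy
      rw [LinearMap.pi_apply_eq_sum_univ l y, Fin.sum_univ_succ, (hP y hy).1, zero_smul, zero_add]
      refine Finset.sum_congr rfl fun i _ => ?_
      rw [smul_eq_mul, mul_comm]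
      congr 2
      funext j
      simp [Pi.single_apply, eq_comm]
    rw [← normalCone_face_newtonPolytope hlam hval]
    have hface : {p ∈ newtonPolytope (schurPoly K lam) |
        ∀ y ∈ newtonPolytope (schurPoly K lam), l y ≤ l p} =
        {p ∈ newtonPolytope (schurPoly K lam) | ∀ y ∈ newtonPolytope (schurPoly K lam),
          (fun i : Fin n => l (Pi.single i.succ 1)) ⬝ᵥ Fin.tail y ≤
            (fun i : Fin n => l (Pi.single i.succ 1)) ⬝ᵥ Fin.tail p} := by
      ext p
      exact and_congr_right fun hp => forall₂_congr fun y hy => by rw [hl y hy, hl p hp]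
    rw [hface]
  · rintro ⟨u, rfl⟩
    obtain ⟨σ, hσ⟩ := exists_isMaximizer lam u
    refine ⟨{p ∈ newtonPolytope (schurPoly K lam) |
        ∀ y ∈ newtonPolytope (schurPoly K lam), u ⬝ᵥ Fin.tail y ≤ u ⬝ᵥ Fin.tail p},
      ⟨⟨Fin.cons 0 (orbitPoint lam σ), cons_orbitPoint_mem_newtonPolytope hlam hval σ,
        fun y hy => by simpa using (hP y hy).2.le hσ⟩,
        (dotProductBilin ℝ ℝ u).comp (LinearMap.funLeft ℝ ℝ Fin.succ), rfl⟩,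
      (normalCone_face_newtonPolytope hlam hval u).symm⟩

end Newton

/-! ### The fan of the Schur module -/

section Fan

variable {K V W : Type*} [Field K] [AddCommGroup V] [Module K V] [AddCommGroup W] [Module K W]

theorem charPairing_charMk (x : Apartment n) (N : Fin n → ℕ) :
    charPairing x (charMk fun i => (N i : ℤ)) = x.1 ⬝ᵥ fun i => (N i : ℝ) := by
  change ∑ i, ((N i : ℤ) : ℝ) * x.1 i = ∑ i, x.1 i * (N i : ℝ)
  simp only [Int.cast_natCast, mul_comm]

theorem weightCone_eq {e : Module.Basis (Fin n) K V}
    {ρ : Representation K (SpecialLinearGroup K V) W}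
    (horb : ∀ σ : Equiv.Perm (Fin n), IsWeight e ρ (charMk fun i => (lam (σ i) : ℤ)))
    (hρ : ∀ μ, IsWeight e ρ μ →
      ∃ N : Fin n → ℕ, μ = charMk (fun i => (N i : ℤ)) ∧ InOrbitHull lam fun i => (N i : ℝ))
    (N : Fin n → ℕ) :
    weightCone e ρ (charMk fun i => (N i : ℤ)) =
      {x | ∀ σ, x.1 ⬝ᵥ orbitPoint lam σ ≤ x.1 ⬝ᵥ fun i => (N i : ℝ)} := by
  ext x
  constructor
  · intro hx σ
    have := hx _ (horb σ)
    rwa [charPairing_charMk, charPairing_charMk] at this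
  · intro hx μ hμ
    obtain ⟨M, rfl, hM⟩ := hρ μ hμ
    obtain ⟨σ, hσ⟩ := hM x.1
    rw [charPairing_charMk, charPairing_charMk]
    exact hσ.trans (hx σ)

/-- A face of the cone on which a point `p` of the hull is maximal is the cell of one of its
elements, namely of one with the fewest maximisers: such an element `u` lies in the relative
interior of the face, in that `u - ε • y` stays in the cone for every `y` in the cell of `u`. -/
theorem exists_eq_orbitCell_of_isFace {p : Fin n → ℝ} (hp : InOrbitHull lam p)
    {F : Set (Apartment n)}
    (hF : IsFace {x : Apartment n | ∀ σ, x.1 ⬝ᵥ orbitPoint lam σ ≤ x.1 ⬝ᵥ p} F) :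
    ∃ u : Apartment n, F = {x | x.1 ∈ orbitCell lam u.1} := by
  classical
  obtain ⟨hne, l, rfl⟩ := hF
  set C : Set (Apartment n) := {x | ∀ σ, x.1 ⬝ᵥ orbitPoint lam σ ≤ x.1 ⬝ᵥ p} with hC
  have hadd : ∀ {x y}, x ∈ C → y ∈ C → x + y ∈ C := by
    intro x y hx hy σ
    change (x.1 + y.1) ⬝ᵥ _ ≤ (x.1 + y.1) ⬝ᵥ _
    rw [add_dotProduct, add_dotProduct]
    exact add_le_add (hx σ) (hy σ)
  have hzero : (0 : Apartment n) ∈ C := fun σ => by simp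
  have hvalue : ∀ {x σ}, x ∈ C → IsMaximizer lam x.1 σ → x.1 ⬝ᵥ orbitPoint lam σ = x.1 ⬝ᵥ p :=
    fun hx hσ => le_antisymm (hx _) (hp.le hσ)
  have hl0 : ∀ {x}, x ∈ C → (∀ y ∈ C, l y ≤ l x) → l x = 0 := by
    intro x hx hmax
    have h1 := hmax _ (hadd hx hx)
    have h2 := hmax 0 hzero
    rw [map_add] at h1
    rw [map_zero] at h2
    linarith
  let f : Apartment n → ℕ := fun x =>
    (Finset.univ.filter fun σ : Equiv.Perm (Fin n) => IsMaximizer lam x.1 σ).card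
  obtain ⟨u, ⟨huC, humax⟩, hmin⟩ := (measure f).wf.has_min _ hne
  have hlu := hl0 huC humax
  refine ⟨u, Set.Subset.antisymm ?_ ?_⟩
  · rintro y ⟨hyC, hymax⟩
    have hsum : ∀ σ, IsMaximizer lam (u + y).1 σ →
        IsMaximizer lam u.1 σ ∧ IsMaximizer lam y.1 σ := by
      intro σ hσ
      have h1 := hvalue (hadd huC hyC) hσ
      change (u.1 + y.1) ⬝ᵥ _ = (u.1 + y.1) ⬝ᵥ _ at h1
      rw [add_dotProduct, add_dotProduct] at h1
      have h2 := huC σ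
      have h3 := hyC σ
      exact ⟨fun τ => by linarith [huC τ], fun τ => by linarith [hyC τ]⟩
    have hmem : u + y ∈ {x ∈ C | ∀ z ∈ C, l z ≤ l x} := by
      refine ⟨hadd huC hyC, fun z hz => ?_⟩
      rw [map_add, hlu, zero_add]
      exact hymax z hz
    have hsub : (Finset.univ.filter fun σ => IsMaximizer lam (u + y).1 σ) ⊆
        Finset.univ.filter fun σ => IsMaximizer lam u.1 σ :=
      Finset.monotone_filter_right _ fun σ _ hσ => (hsum σ hσ).1
    have heq := Finset.eq_of_subset_of_card_le hsub (not_lt.1 (hmin _ hmem))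
    intro σ hσ
    have : σ ∈ Finset.univ.filter fun σ => IsMaximizer lam (u + y).1 σ := by
      rw [heq]
      exact Finset.mem_filter.2 ⟨Finset.mem_univ _, hσ⟩
    exact (hsum σ (Finset.mem_filter.1 this).2).2
  · intro y hy
    have hyC : y ∈ C := hp.le_of_isMaximizer hy huC
    obtain ⟨ε, hε, hmax⟩ := exists_pos_isMaximizer_sub_smul hy
    obtain ⟨τ, hτ⟩ := exists_isMaximizer lam u.1
    have hsubC : u - ε • y ∈ C := by
      intro σ
      change (u.1 - ε • y.1) ⬝ᵥ _ ≤ (u.1 - ε • y.1) ⬝ᵥ _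
      refine (hmax τ hτ σ).trans (le_of_eq ?_)
      rw [sub_dotProduct, sub_dotProduct, smul_dotProduct, smul_dotProduct, hvalue huC hτ,
        hvalue hyC (hy τ hτ)]
    have h1 := humax _ hsubC
    have h2 := humax _ hyC
    rw [map_sub, map_smul, smul_eq_mul] at h1
    have h3 : 0 ≤ l y := nonneg_of_mul_nonneg_right (by linarith : 0 ≤ ε * l y) hε
    exact ⟨hyC, fun z hz => (humax z hz).trans (by linarith)⟩

/-- The cell of `u` is the face of the cone of a maximiser `λ ∘ σ` of `u` on which the sum of the
differences of the other maximisers with `λ ∘ σ` vanishes. -/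
theorem isFace_orbitCell {u : Apartment n} {σ : Equiv.Perm (Fin n)}
    (hσ : IsMaximizer lam u.1 σ) :
    IsFace {x : Apartment n | ∀ τ, x.1 ⬝ᵥ orbitPoint lam τ ≤ x.1 ⬝ᵥ orbitPoint lam σ}
      {x | x.1 ∈ orbitCell lam u.1} := by
  classical
  refine ⟨⟨u, fun _ h => h⟩, ?_⟩
  let s : Finset (Equiv.Perm (Fin n)) := Finset.univ.filter fun τ => IsMaximizer lam u.1 τ
  let d : Fin n → ℝ := ∑ τ ∈ s, (orbitPoint lam τ - orbitPoint lam σ)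
  let l : Apartment n →ₗ[ℝ] ℝ := (dotProductBilin ℝ ℝ d).comp (Apartment n).subtype
  have hl : ∀ x : Apartment n,
      l x = ∑ τ ∈ s, (x.1 ⬝ᵥ orbitPoint lam τ - x.1 ⬝ᵥ orbitPoint lam σ) := by
    intro x
    change d ⬝ᵥ x.1 = _
    rw [dotProduct_comm, dotProduct_sum]
    simp only [dotProduct_sub]
  refine ⟨l, Set.ext fun x => ⟨fun hx => ⟨hx σ hσ, fun y hy => ?_⟩, fun hx τ hτ => ?_⟩⟩
  · have h0 : l x = 0 := by
      rw [hl]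
      refine Finset.sum_eq_zero fun τ hτ => ?_
      rw [(hx τ (Finset.mem_filter.1 hτ).2).eq (hx σ hσ), sub_self]
    rw [h0, hl]
    exact Finset.sum_nonpos fun τ _ => sub_nonpos.2 (hy τ)
  · have h0 := hx.2 0 (fun τ => by simp)
    rw [map_zero, hl] at h0
    have hz := (Finset.sum_eq_zero_iff_of_nonpos fun τ _ => sub_nonpos.2 (hx.1 τ)).1
      (le_antisymm (Finset.sum_nonpos fun τ _ => sub_nonpos.2 (hx.1 τ)) h0) τ
      (Finset.mem_filter.2 ⟨Finset.mem_univ _, hτ⟩)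
    intro υ
    exact (hx.1 υ).trans (sub_eq_zero.1 hz).ge

theorem repFan_eq {m : ℕ} {lam : Fin (m + 1) → ℕ} (hlam : Antitone lam)
    {e : Module.Basis (Fin (m + 1)) K V} {ρ : Representation K (SpecialLinearGroup K V) W}
    (horb : ∀ σ : Equiv.Perm (Fin (m + 1)), IsWeight e ρ (charMk fun i => (lam (σ i) : ℤ)))
    (hρ : ∀ μ, IsWeight e ρ μ → ∃ N : Fin (m + 1) → ℕ,
      μ = charMk (fun i => (N i : ℤ)) ∧ InOrbitHull lam fun i => (N i : ℝ)) :
    repFan e ρ = Set.range fun u : Apartment (m + 1) => {x | x.1 ∈ orbitCell lam u.1} := by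
  ext F
  constructor
  · rintro ⟨Δ, μ₀, -, hμ₀, hF⟩
    obtain ⟨N, rfl, hN⟩ := hρ μ₀ hμ₀.1
    rw [weightCone_eq horb hρ] at hF
    obtain ⟨u, hu⟩ := exists_eq_orbitCell_of_isFace hN hF
    exact ⟨u, hu.symm⟩
  · rintro ⟨u, rfl⟩
    obtain ⟨σ, hσ⟩ := exists_antitone_comp u.1
    refine ⟨simpleRoots σ, _, isRootBasis_simpleRoots σ,
      isHighestWeight_simpleRoots hlam σ (horb σ⁻¹) hρ, ?_⟩
    rw [weightCone_eq horb hρ (fun i => lam (σ⁻¹ i))]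
    exact isFace_orbitCell (isMaximizer_inv_of_antitone hlam hσ)

end Fan

end Cells

end TropicalSchur

open TropicalSchur in
theorem theorem2p4 {K : Type*} [NontriviallyNormedField K] [IsUltrametricDist K] [CharZero K]
    {n : ℕ} (hn : 2 ≤ n)
    {V : Type*} [AddCommGroup V] [Module K V] (e : Module.Basis (Fin n) K V)
    (lam : Fin n → ℕ) (hlam : Antitone lam)
    {W : Type*} [AddCommGroup W] [Module K W]
    (ρ : Representation K (SpecialLinearGroup K V) W)
    (hρ : Nonempty (ρ.Equiv (schurRep K V lam)))
    (hval : ∀ N ∈ (schurPoly K lam).support, val ((schurPoly K lam).coeff N) = 0) :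
    (fun C : Set (Apartment n) => apartmentEquiv n '' C) '' repFan e ρ =
      (fun D : Set (Fin n → ℝ) => toTropicalTorus n '' D) '' tropComplex (schurPoly K lam) := by
  obtain ⟨m, rfl⟩ : ∃ m, n = m + 1 := ⟨n - 1, by omega⟩
  obtain ⟨φ⟩ := hρ
  rw [tropComplex_schurPoly hlam hval,
    repFan_eq hlam (fun σ => (isWeight_schurRep_orbit e σ).of_equiv e φ.symm)
      fun μ hμ => exists_of_isWeight_schurRep e hlam (hμ.of_equiv e φ),
    ← Set.range_comp, ← Set.range_comp]
  ext Z
  simp only [Set.mem_range, Function.comp_apply, apartmentEquiv_image_orbitCell]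
  constructor
  · rintro ⟨u, rfl⟩
    exact ⟨u.1, rfl⟩
  · rintro ⟨u, rfl⟩
    obtain ⟨v, hv⟩ := (apartmentEquiv (m + 1)).surjective (toTropicalTorus (m + 1) u)
    exact ⟨v, by rw [orbitCell_congr (show toTropicalTorus (m + 1) v.1 = _ from hv)]⟩
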